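/- Let $D=(V,A)$ be a finite digraph. A \emph{source} (\emph{sink}) of $D$ is a vertex without incoming (outgoing) arcs, and $\mathcal U(D)$ denotes the underlying undirected graph of $D$. An undirected graph is \emph{chordal-bipartite} if it is bipartite and has no induced cycle of length at least six. An instance of \textsc{Source Cover} is a weakly connected acyclic digraph $D$ with at least one arc; the task is to find a set $S$ of sources of $D$ of minimum cardinality such that every sink of $D$ is reachable from some vertex of $S$ by a directed path. \textbf{Theorem.} \textsc{Source Cover} restricted to instances $D$ such that $\mathcal U(D)$ is chordal-bipartite can be solved in polynomial time: there are a program for a random access machine (with unit-cost addition and truncated subtraction on natural numbers, and indirect addressing) and a polynomial $p$ such that, for every such instance $D$ on $\{0,\dots,n-1\}$, the program, given $n$ and the adjacency matrix of $D$, halts after at most $p(n)$ steps and outputs a minimum-cardinality set $S$ as above. Moreover, let $F(D)$ be the digraph whose vertices are the sources and the sinks of $D$, with an arc $st$ for every source $s$ and every sink $t$ of $D$ such that $t$ is reachable from $s$ in $D$ (so that $\mathcal U(F(D))$ is the incidence graph between the sources, viewed as sets, and the sinks, viewed as items, of a \textsc{Set Cover} instance). If $D$ is an instance of \textsc{Source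 Cover} and $\mathcal U(D)$ is chordal-bipartite, then $\mathcal U(F(D))$ is chordal-bipartite. -/

import Mathlib

/-! ### Digraphs and the Source Cover problem -/

namespace Digraph

variable {V : Type*}

/-- A source: a vertex without incoming arcs. -/
def IsSource (D : Digraph V) (v : V) : Prop := ∀ u, ¬ D.Adj u v

/-- A sink: a vertex without outgoing arcs. -/
def IsSink (D : Digraph V) (v : V) : Prop := ∀ w, ¬ D.Adj v w

/-- `w` is reachable from `v` by a (possibly trivial) directed path. -/
def Reaches (D : Digraph V) (v w : V) : Prop := Relation.ReflTransGen D.Adj v w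

/-- No closed directed walk of positive length; in particular no loop. -/
def IsAcyclic (D : Digraph V) : Prop := ∀ v, ¬ Relation.TransGen D.Adj v v

/-- The underlying undirected (simple) graph. -/
def underlying (D : Digraph V) : SimpleGraph V := D.toSimpleGraphInclusive

/-- An instance of Source Cover: a weakly connected acyclic digraph with at least one arc. -/
structure IsSourceCoverInstance (D : Digraph V) : Prop where
  acyclic : D.IsAcyclic
  weaklyConnected : D.underlying.Connected
  hasArc : ∃ u v, D.Adj u v

/-- A set of sources such that every sink is reachable from one of its members. -/
def IsSourceCover (D : Digraph V) (S : Finset V) : Prop :=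
  (∀ s ∈ S, D.IsSource s) ∧ ∀ t, D.IsSink t → ∃ s ∈ S, D.Reaches s t

/-- A source cover of minimum cardinality. -/
def IsMinimumSourceCover (D : Digraph V) (S : Finset V) : Prop :=
  D.IsSourceCover S ∧ ∀ T : Finset V, D.IsSourceCover T → S.card ≤ T.card

/-- The flattening of `D`: its vertices are the sources and the sinks of `D`, with an arc from a
source `s` to a sink `t` whenever `t` is reachable from `s` in `D`. -/
def flatten (D : Digraph V) : Digraph {v : V // D.IsSource v ∨ D.IsSink v} where
  Adj s t := D.IsSource s.1 ∧ D.IsSink t.1 ∧ D.Reaches s.1 t.1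

end Digraph

/-- Chordal-bipartite graphs: bipartite, and without induced cycles of length at least six. -/
def SimpleGraph.IsChordalBipartite {V : Type*} (G : SimpleGraph V) : Prop :=
  G.IsBipartite ∧ ∀ k, 6 ≤ k → ¬ (SimpleGraph.cycleGraph k).IsIndContained G

/-! ### Random access machines

Unit-cost random access machines, programmed by structured (while-) programs. A program mentions
finitely many registers and finitely many arrays; registers and array cells hold natural numbers.
The arithmetic operations are addition and truncated subtraction only (there is no
multiplication), so that a number that occurs within `t` steps has only `O(t)` more bits than the
numbers in the input and the program, and time is polynomially related to time on
Turing machines. -/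

namespace RAM

/-- Expressions: literals, registers, indirectly addressed array cells, sums and truncated
differences. -/
inductive Expr : Type
  | lit (k : ℕ)
  | var (x : ℕ)
  | get (a : ℕ) (i : Expr)
  | add (e f : Expr)
  | sub (e f : Expr)

/-- Programs. -/
inductive Cmd : Type
  | skip
  /-- register `x` receives the value of `e` -/
  | assign (x : ℕ) (e : Expr)
  /-- cell `i` of array `a` receives the value of `e` -/
  | store (a : ℕ) (i e : Expr)
  | seq (c d : Cmd)
  /-- execute `c` if the value of `e` is nonzero, and `d` otherwise -/
  | ite (e : Expr) (c d : Cmd)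
  /-- execute `c` as long as the value of `e` is nonzero -/
  | loop (e : Expr) (c : Cmd)

/-- Memory contents: `var x` is the content of register `x`, and `arr a i` is the content of
cell `i` of array `a`. -/
@[ext] structure State : Type where
  var : ℕ → ℕ
  arr : ℕ → ℕ → ℕ

/-- The value of an expression. -/
def Expr.eval (s : State) : Expr → ℕ
  | lit k => k
  | var x => s.var x
  | get a i => s.arr a (i.eval s)
  | add e f => e.eval s + f.eval s
  | sub e f => e.eval s - f.eval s

/-- The number of steps for evaluating an expression: one for each of its nodes. -/
def Expr.cost : Expr → ℕ
  | lit _ => 1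
  | var _ => 1
  | get _ i => i.cost + 1
  | add e f => e.cost + f.cost + 1
  | sub e f => e.cost + f.cost + 1

/-- Overwrite register `x`. -/
def State.setVar (s : State) (x v : ℕ) : State :=
  { s with var := Function.update s.var x v }

/-- Overwrite cell `i` of array `a`. -/
def State.setArr (s : State) (a i v : ℕ) : State :=
  { s with arr := Function.update s.arr a (Function.update (s.arr a) i v) }

/-- `Exec c s s' t`: started in memory `s`, the program `c` halts in memory `s'` after exactly
`t` steps. -/
inductive Exec : Cmd → State → State → ℕ → Prop
  | skip (s : State) : Exec .skip s s 1
  | assign (s : State) (x : ℕ) (e : Expr) :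
      Exec (.assign x e) s (s.setVar x (e.eval s)) (e.cost + 1)
  | store (s : State) (a : ℕ) (i e : Expr) :
      Exec (.store a i e) s (s.setArr a (i.eval s) (e.eval s)) (i.cost + e.cost + 1)
  | seq {c d : Cmd} {s s' s'' : State} {t t' : ℕ} :
      Exec c s s' t → Exec d s' s'' t' → Exec (.seq c d) s s'' (t + t')
  | ite_true {e : Expr} {c d : Cmd} {s s' : State} {t : ℕ} :
      e.eval s ≠ 0 → Exec c s s' t → Exec (.ite e c d) s s' (e.cost + 1 + t)
  | ite_false {e : Expr} {c d : Cmd} {s s' : State} {t : ℕ} :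
      e.eval s = 0 → Exec d s s' t → Exec (.ite e c d) s s' (e.cost + 1 + t)
  | loop_done {e : Expr} {c : Cmd} {s : State} :
      e.eval s = 0 → Exec (.loop e c) s s (e.cost + 1)
  | loop_step {e : Expr} {c : Cmd} {s s' s'' : State} {t t' : ℕ} :
      e.eval s ≠ 0 → Exec c s s' t → Exec (.loop e c) s' s'' t' →
      Exec (.loop e c) s s'' (e.cost + 1 + t + t')

open Classical in
/-- The memory that holds a digraph `D` on `{0, …, n-1}` as input: register `0` contains `n`, array
`0` contains the adjacency matrix of `D`, row by row, and everything else is `0`. -/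
noncomputable def input {n : ℕ} (D : Digraph (Fin n)) : State where
  var x := if x = 0 then n else 0
  arr a k := if a = 0 ∧ ∃ i j : Fin n, k = i * n + j ∧ D.Adj i j then 1 else 0

/-- The set of vertices that is read off as output: those whose cell in array `1` contains `1`. -/
def output (n : ℕ) (s : State) : Finset (Fin n) :=
  Finset.univ.filter fun v => s.arr 1 v = 1

end RAM

/-!
Write `u ≤ v` if `v` is reachable from `u` in `D`. Everything rests on one property of an acyclic
digraph `D` whose underlying graph has no induced cycle of length at least six
(`Digraph.IsAcyclic.not_bypassed`): if `x ≤ a` and `x ≤ b`, then an ancestor `u` of `a` and an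
ancestor `v` of `b` are never linked, in the underlying graph, by a walk all of whose vertices `w`
satisfy `¬ x ≤ w` and `¬ (w ≤ a ∧ w ≤ b)`. To see this, take `a` and `b` minimal for the order `≤`.
Then a shortest path from `a` to `b` through such vertices has no edge to the interior of a shortest
path from `a` to `b` through descendants of `x` that reach `a` or `b`: such an edge would be an arc
from the first path to a vertex `y` of the second, and `y` could replace `a` or `b`. Together the
two paths form an induced cycle, of length at least six because `a` and `b` are not
adjacent and no interior vertex of the first path reaches both.

An induced cycle of length at least six in the flattening of `D` violates this property: let `x` be
a source on it, `a` and `b` the neighbours of `x`, and follow the rest of the cycle. This gives the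
second part of the theorem.

For the algorithm, the same property, applied to sources and a set `U` of sinks, shows that for a
suitable `t ∈ U` one of the sources reaching `t` reaches every element of `U` that is reached by any
of them (`Digraph.IsAcyclic.exists_dominating_source`). The combinatorial core is
`exists_dominating_set_aux`, an induction similar to Dirac's proof that a chordal graph has a
simplicial vertex outside any given clique other than the whole graph. If `U` is the set of sinks
that are not yet covered, such a source can be exchanged for any member of a source cover that
covers `t` (`Digraph.IsExtendable.insert`), so that selecting it is optimal. The program computes
the reachability relation by Warshall's algorithm and then tries, in each of `n` rounds, all pairs
of a source and an uncovered sink for this domination property; each round covers a new sink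
unless none is left.

Programs are written in a language `RAM.Prog` of counting loops, which is translated into
while-programs. There the polynomial time bound can be read off from the syntax
(`RAM.Prog.exec_compile`), and correctness is a statement about the function `RAM.Prog.run` on
memory states, proved by loop invariants (`RAM.Prog.run_forVar_induction`).
-/

/-! ### Induced cycles from chordless paths -/

namespace SimpleGraph

variable {V : Type*} {G : SimpleGraph V}

/-- `f 0, …, f l` is a chordless path of `G` from `a` to `b` whose interior lies in `B`. -/
structure IsChordlessPath (G : SimpleGraph V) (B : Set V) (a b : V) (l : ℕ) (f : ℕ → V) :
    Prop where
  start : f 0 = a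
  finish : f l = b
  step : ∀ i < l, G.Adj (f i) (f (i + 1))
  mem : ∀ i, 0 < i → i < l → f i ∈ B
  chordless : ∀ i j, i < j → j ≤ l → G.Adj (f i) (f j) → j = i + 1
  injective : ∀ i j, i < j → j ≤ l → f i ≠ f j

/-- `u` and `v` are joined by a walk of `G` inside `B`. -/
def LinkedIn (G : SimpleGraph V) (B : Set V) : V → V → Prop :=
  Relation.ReflTransGen fun x y => x ∈ B ∧ y ∈ B ∧ G.Adj x y

theorem LinkedIn.mono {B C : Set V} (h : B ⊆ C) {u v : V} (huv : G.LinkedIn B u v) :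
    G.LinkedIn C u v := by
  induction huv with
  | refl => exact .refl
  | tail _ h' ih => exact ih.tail ⟨h h'.1, h h'.2.1, h'.2.2⟩

theorem LinkedIn.symm {B : Set V} {u v : V} (huv : G.LinkedIn B u v) : G.LinkedIn B v u := by
  induction huv with
  | refl => exact .refl
  | tail _ h ih => exact ih.head ⟨h.2.1, h.1, h.2.2.symm⟩

theorem LinkedIn.exists_walk {B : Set V} {u v b : V} (huv : G.LinkedIn B u v) (hv : v ∈ B)
    (hb : G.Adj v b) :
    ∃ (l : ℕ) (f : ℕ → V), f 0 = u ∧ f l = b ∧ (∀ i < l, G.Adj (f i) (f (i + 1))) ∧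
      ∀ i < l, f i ∈ B := by
  induction huv using Relation.ReflTransGen.head_induction_on with
  | refl =>
    refine ⟨1, fun i => if i = 0 then v else b, by simp, by simp, ?_, ?_⟩ <;>
    · intro i hi
      obtain rfl : i = 0 := by omega
      simpa
  | @head x y h _ ih =>
    obtain ⟨l, f, h0, hl, hs, hm⟩ := ih
    refine ⟨l + 1, fun i => i.casesOn x f, rfl, hl, ?_, ?_⟩
    · rintro (_ | i) hi
      · simpa [h0] using h.2.2
      · exact hs i (by omega)
    · rintro (_ | i) hi
      · exact h.1
      · exact hm i (by omega)

/-- A shortest walk is a chordless path. -/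
theorem LinkedIn.exists_isChordlessPath {B : Set V} {a b u v : V} (huv : G.LinkedIn B u v)
    (hv : v ∈ B) (ha : G.Adj a u) (hb : G.Adj v b) (hab : a ≠ b) (hbB : b ∉ B) :
    ∃ l f, G.IsChordlessPath B a b l f := by
  classical
  let P : ℕ → Prop := fun l => ∃ f : ℕ → V, f 0 = a ∧ f l = b ∧
    (∀ i < l, G.Adj (f i) (f (i + 1))) ∧ ∀ i, 0 < i → i < l → f i ∈ B
  have hP : ∃ l, P l := by
    obtain ⟨l, f, h0, hl, hs, hm⟩ := huv.exists_walk hv hb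
    refine ⟨l + 1, fun i => i.casesOn a f, rfl, hl, ?_, ?_⟩
    · rintro (_ | i) hi
      · simpa [h0] using ha
      · exact hs i (by omega)
    · rintro (_ | i) h0 hi
      · omega
      · exact hm i (by omega)
  obtain ⟨f, h0, hl, hs, hm⟩ := Nat.find_spec hP
  have hmin : ∀ l, P l → Nat.find hP ≤ l := fun l h => Nat.find_min' hP h
  generalize Nat.find hP = l at *
  -- a chord would give a shorter walk
  have hch : ∀ i j, i < j → j ≤ l → G.Adj (f i) (f j) → j = i + 1 := by
    intro i j hij hj hadj
    by_contra hne
    have := hmin (l - (j - i - 1)) ⟨fun n => if n ≤ i then f n else f (n + (j - i - 1)), ?_, ?_,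
      ?_, ?_⟩
    · omega
    · simpa using h0
    · dsimp only
      rw [if_neg (by omega), show l - (j - i - 1) + (j - i - 1) = l by omega, hl]
    · intro n hn
      rcases lt_trichotomy n i with h | rfl | h
      · simpa [h.le, Nat.succ_le_of_lt h] using hs n (by omega)
      · simpa [show n + 1 + (j - n - 1) = j by omega] using hadj
      · simpa [show ¬ n ≤ i by omega, show ¬ n + 1 ≤ i by omega,
          show n + 1 + (j - i - 1) = n + (j - i - 1) + 1 by omega] using
          hs (n + (j - i - 1)) (by omega)
    · intro n hn0 hn
      dsimp only
      split_ifs with h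
      · exact hm n hn0 (by omega)
      · exact hm _ (by omega) (by omega)
  refine ⟨l, f, h0, hl, hs, hm, hch, ?_⟩
  intro i j hij hj heq
  rcases hj.lt_or_eq with hj | rfl
  · have := hch i (j + 1) (by omega) (by omega) (heq ▸ hs j hj)
    omega
  · rcases Nat.eq_zero_or_pos i with rfl | hi
    · exact hab (by rw [← h0, heq, hl])
    · exact hbB (by rw [← hl, ← heq]; exact hm i hi hij)

theorem cycleGraph_adj_iff_of_lt {n : ℕ} {u v : Fin n} (h : u < v) :
    (cycleGraph n).Adj u v ↔ (v : ℕ) = u + 1 ∨ ((u : ℕ) = 0 ∧ (v : ℕ) + 1 = n) := by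
  have hv := v.2
  have hu : (u : ℕ) < v := h
  rw [cycleGraph_adj', Fin.sub_val_of_le h.le, Fin.val_sub, Nat.mod_eq_of_lt (by omega)]
  omega

/-- Two chordless paths with common ends form an induced cycle if their interiors are disjoint and
no edge joins them. -/
theorem IsChordlessPath.cycleGraph_isIndContained {S B : Set V} {a b : V} {p q : ℕ} {f g : ℕ → V}
    (hf : G.IsChordlessPath S a b p f) (hg : G.IsChordlessPath B a b q g) (hp : 2 ≤ p)
    (hq : 2 ≤ q) (hdis : Disjoint S B) (hadj : ∀ x ∈ S, ∀ y ∈ B, ¬ G.Adj x y) :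
    (cycleGraph (p + q)).IsIndContained G := by
  let φ : Fin (p + q) → V := fun i => if (i : ℕ) ≤ p then f i else g (p + q - i)
  have key : ∀ i j : Fin (p + q), i < j →
      φ i ≠ φ j ∧ (G.Adj (φ i) (φ j) ↔ (cycleGraph (p + q)).Adj i j) := by
    rintro ⟨i, hi⟩ ⟨j, hj2⟩ hij
    rw [cycleGraph_adj_iff_of_lt hij]
    have hij' : i < j := hij
    simp only [φ]
    by_cases hjp : j ≤ p
    · rw [if_pos (by omega), if_pos hjp]
      refine ⟨hf.injective i j hij' hjp, fun h => Or.inl (hf.chordless i j hij' hjp h), fun h => ?_⟩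
      obtain rfl : j = i + 1 := by omega
      exact hf.step i (by omega)
    · rw [if_neg hjp]
      by_cases hip : i ≤ p
      · rw [if_pos hip]
        rcases Nat.eq_zero_or_pos i with rfl | hi0
        · rw [hf.start, ← hg.start]
          refine ⟨hg.injective _ _ (by omega) (by omega), fun h => ?_, fun h => ?_⟩
          · have := hg.chordless _ _ (by omega) (by omega) h
            omega
          · rw [show p + q - j = 0 + 1 by omega]
            exact hg.step 0 (by omega)
        · rcases hip.lt_or_eq with hip | rfl
          · have h1 := hf.mem i hi0 hip
            have h2 := hg.mem (p + q - j) (by omega) (by omega)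
            refine ⟨fun h => Set.disjoint_left.1 hdis h1 (h ▸ h2), fun h => ?_, fun h => ?_⟩
            · exact absurd h (hadj _ h1 _ h2)
            · omega
          · rw [hf.finish, ← hg.finish]
            refine ⟨(hg.injective _ _ (by omega) le_rfl).symm, fun h => ?_, fun h => ?_⟩
            · have := hg.chordless _ _ (by omega) le_rfl h.symm
              omega
            · have := hg.step (i + q - j) (by omega)
              rw [show i + q - j + 1 = q by omega] at this
              exact this.symm
      · rw [if_neg hip]
        refine ⟨(hg.injective _ _ (by omega) (by omega)).symm, fun h => ?_, fun h => ?_⟩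
        · have := hg.chordless _ _ (by omega) (by omega) h.symm
          omega
        · have := hg.step (p + q - j) (by omega)
          rw [show p + q - j + 1 = p + q - i by omega] at this
          exact this.symm
  have hinj : Function.Injective φ := by
    intro i j h
    rcases lt_trichotomy i j with hij | hij | hij
    · exact absurd h (key i j hij).1
    · exact hij
    · exact absurd h.symm (key j i hij).1
  refine ⟨⟨⟨φ, hinj⟩, ?_⟩⟩
  · intro i j
    change G.Adj (φ i) (φ j) ↔ _
    rcases lt_trichotomy i j with hij | hij | hij
    · exact (key i j hij).2
    · subst hij; simp
    · rw [G.adj_comm, (key j i hij).2, (cycleGraph (p + q)).adj_comm]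

end SimpleGraph

/-! ### Bypasses of a common ancestor -/

namespace SimpleGraph

variable {V : Type*} {G : SimpleGraph V}

theorem LinkedIn.linkedIn_component {B : Set V} {u v : V} (huv : G.LinkedIn B u v) :
    G.LinkedIn {w | w ∈ B ∧ G.LinkedIn B w v} u v := by
  induction huv using Relation.ReflTransGen.head_induction_on with
  | refl => exact .refl
  | head h h' ih => exact ih.head ⟨⟨h.1, h'.head h⟩, ⟨h.2.1, h'⟩, h.2.2⟩

end SimpleGraph

namespace Digraph

variable {V : Type*} {D : Digraph V}

theorem underlying_adj {u v : V} : D.underlying.Adj u v ↔ u ≠ v ∧ (D.Adj u v ∨ D.Adj v u) :=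
  SimpleGraph.fromRel_adj _ _ _

theorem IsAcyclic.underlying_adj_of_adj (hD : D.IsAcyclic) {u v : V} (h : D.Adj u v) :
    D.underlying.Adj u v :=
  underlying_adj.2 ⟨fun e => hD u (.single (e ▸ h)), .inl h⟩

theorem Reaches.transGen {u v : V} (h : D.Reaches u v) (hne : u ≠ v) :
    Relation.TransGen D.Adj u v :=
  (Relation.reflTransGen_iff_eq_or_transGen.1 h).resolve_left (Ne.symm hne)

theorem IsAcyclic.wellFounded [Finite V] (hD : D.IsAcyclic) :
    WellFounded (Relation.TransGen D.Adj) := by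
  have : Std.Irrefl (Relation.TransGen D.Adj) := ⟨hD⟩
  exact Finite.wellFounded_of_trans_of_irrefl _

theorem Reaches.trans {u v w : V} (h : D.Reaches u v) (h' : D.Reaches v w) : D.Reaches u w :=
  Relation.ReflTransGen.trans h h'

theorem Reaches.of_adj {u v : V} (h : D.Adj u v) : D.Reaches u v := .single h

/-- If directed paths to `a` can leave `S` only on arriving at `a`, then one that starts in `S` ends
with an arc from `S` to `a`. -/
theorem Reaches.exists_adj_of_closed {S : Set V} {a w : V}
    (hS : ∀ w ∈ S, ∀ w', D.Adj w w' → D.Reaches w' a → w' ≠ a → w' ∈ S)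
    (h : D.Reaches w a) (hw : w ∈ S) (ha : a ∉ S) : ∃ u ∈ S, D.Adj u a := by
  induction h using Relation.ReflTransGen.head_induction_on with
  | refl => exact absurd hw ha
  | @head w w' h h' ih =>
    by_cases hne : w' = a
    · exact ⟨w, hw, hne ▸ h⟩
    · exact ih (hS w hw w' h h' hne)

/-- The vertices that are not reachable from `x` and do not reach both `a` and `b`. -/
def bypass (D : Digraph V) (x a b : V) : Set V :=
  {w | ¬ D.Reaches x w ∧ ¬ (D.Reaches w a ∧ D.Reaches w b)}

/-- A common ancestor `x` of `a` and `b` is bypassed: a vertex that reaches `a` and a vertex that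
reaches `b` are linked by a walk of the underlying graph in `D.bypass x a b`. -/
def Bypassed (D : Digraph V) (x a b : V) : Prop :=
  D.Reaches x a ∧ D.Reaches x b ∧ ∃ u ∈ D.bypass x a b, ∃ v ∈ D.bypass x a b,
    D.Reaches u a ∧ D.Reaches v b ∧ D.underlying.LinkedIn (D.bypass x a b) u v

theorem bypass_comm (x a b : V) : D.bypass x a b = D.bypass x b a := by
  simp only [bypass, and_comm]

theorem bypass_subset {a' b' x a b : V} (ha : D.Reaches a' a) (hb : D.Reaches b' b) :
    D.bypass x a b ⊆ D.bypass x a' b' :=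
  fun _ hw => ⟨hw.1, fun h => hw.2 ⟨h.1.trans ha, h.2.trans hb⟩⟩

theorem mem_bypass_of_reaches {x a b w w' : V} (hw : w ∈ D.bypass x a b) (h : D.Reaches w w')
    (hx : ¬ D.Reaches x w') : w' ∈ D.bypass x a b :=
  ⟨hx, fun h' => hw.2 ⟨h.trans h'.1, h.trans h'.2⟩⟩

theorem Bypassed.symm {x a b : V} (h : D.Bypassed x a b) : D.Bypassed x b a := by
  obtain ⟨ha, hb, u, hu, v, hv, hua, hvb, huv⟩ := h
  rw [bypass_comm] at hu hv huv
  exact ⟨hb, ha, v, hv, u, hu, hvb, hua, huv.symm⟩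

/-- If `a` is minimal, the walk of a bypass can be taken to start next to `a`. -/
theorem exists_adj_of_minimal (hD : D.IsAcyclic) {x a b u v : V} (ha : D.Reaches x a)
    (hb : D.Reaches x b) (hmin : ∀ z, Relation.TransGen D.Adj z a → ¬ D.Bypassed x z b)
    (hu : u ∈ D.bypass x a b) (hv : v ∈ D.bypass x a b) (hua : D.Reaches u a)
    (hvb : D.Reaches v b) (huv : D.underlying.LinkedIn (D.bypass x a b) u v) :
    ∃ u' ∈ D.bypass x a b, D.Adj u' a ∧ D.underlying.LinkedIn (D.bypass x a b) u' v := by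
  have := hua.exists_adj_of_closed
    (S := {w | w ∈ D.bypass x a b ∧ D.underlying.LinkedIn (D.bypass x a b) w v}) ?_ ⟨hu, huv⟩
    (fun h => h.1.1 ha)
  · obtain ⟨u', ⟨h1, h2⟩, h3⟩ := this
    exact ⟨u', h1, h3, h2⟩
  rintro w ⟨hw, hwv⟩ w' hww' hw'a hne
  by_cases hx : D.Reaches x w'
  · -- otherwise `a` could be replaced by `w'`
    have hsub : D.bypass x a b ⊆ D.bypass x w' b := bypass_subset hw'a .refl
    exact absurd ⟨hx, hb, w, hsub hw, v, hsub hv, .of_adj hww', hvb, hwv.mono hsub⟩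
      (hmin w' (hw'a.transGen hne))
  · have hw' := mem_bypass_of_reaches hw (.of_adj hww') hx
    exact ⟨hw', hwv.head ⟨hw', hw, (hD.underlying_adj_of_adj hww').symm⟩⟩

/-- The vertices other than `a` and `b` on directed paths from `x` to `a` or `b`. -/
def betweenPaths (D : Digraph V) (x a b : V) : Set V :=
  {w | D.Reaches x w ∧ (D.Reaches w a ∨ D.Reaches w b) ∧ w ≠ a ∧ w ≠ b}

theorem betweenPaths_comm (x a b : V) : D.betweenPaths x a b = D.betweenPaths x b a := by
  ext w
  simp only [betweenPaths, Set.mem_ofPred_eq]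
  tauto

theorem exists_adj_betweenPaths (hD : D.IsAcyclic) {x a b : V} (ha : D.Reaches x a)
    (hab : ¬ D.Reaches a b) (hba : ¬ D.Reaches b a) (hb : D.Reaches x b) :
    ∃ u ∈ D.betweenPaths x a b, D.Adj u a ∧
      D.underlying.LinkedIn (D.betweenPaths x a b) u x := by
  have hx : x ∈ D.betweenPaths x a b :=
    ⟨.refl, .inl ha, fun h => hab (h ▸ hb), fun h => hba (h ▸ ha)⟩
  have := ha.exists_adj_of_closed
    (S := {w | w ∈ D.betweenPaths x a b ∧ D.underlying.LinkedIn (D.betweenPaths x a b) w x})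
    ?_ ⟨hx, .refl⟩ (fun h => h.1.2.2.1 rfl)
  · obtain ⟨u', ⟨h1, h2⟩, h3⟩ := this
    exact ⟨u', h1, h3, h2⟩
  rintro w ⟨hw, hwx⟩ w' hww' hw'a hne
  have hw' : w' ∈ D.betweenPaths x a b :=
    ⟨hw.1.trans (.of_adj hww'), .inl hw'a, hne, fun h => hba (h ▸ hw'a)⟩
  exact ⟨hw', hwx.head ⟨hw', hw, (hD.underlying_adj_of_adj hww').symm⟩⟩

/-- A bypassed common ancestor forces an induced cycle of length at least six in the underlying
graph: for minimal `a` and `b`, no edge joins the interior of a shortest path from `a` to `b`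
through descendants of `x` to the interior of a shortest path through the bypass. -/
theorem IsAcyclic.not_bypassed [Finite V] (hD : D.IsAcyclic)
    (hno : ∀ k, 6 ≤ k → ¬ (SimpleGraph.cycleGraph k).IsIndContained D.underlying) (x a b : V) :
    ¬ D.Bypassed x a b := by
  induction a using hD.wellFounded.induction generalizing b with
  | _ a iha =>
  induction b using hD.wellFounded.induction with
  | _ b ihb =>
  rintro ⟨ha, hb, u, hu, v, hv, hua, hvb, huv⟩
  obtain ⟨u, hu, hua, huv⟩ := exists_adj_of_minimal hD ha hb (fun z hz => iha z hz b) hu hv hua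
    hvb huv
  obtain ⟨v, hv, hvb, huv⟩ : ∃ v' ∈ D.bypass x a b, D.Adj v' b ∧
      D.underlying.LinkedIn (D.bypass x a b) u v' := by
    rw [bypass_comm] at hu hv huv
    obtain ⟨v', h1, h2, h3⟩ := exists_adj_of_minimal hD hb ha
      (fun z hz h => ihb z hz h.symm) hv hu hvb (.of_adj hua) huv.symm
    rw [bypass_comm] at h1 h3
    exact ⟨v', h1, h2, h3.symm⟩
  have hab : ¬ D.Reaches a b := fun h => hu.2 ⟨.of_adj hua, .head hua h⟩
  have hba : ¬ D.Reaches b a := fun h => hv.2 ⟨.head hvb h, .of_adj hvb⟩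
  have hne : a ≠ b := fun h => hab (h ▸ .refl)
  have hnadj : ¬ D.underlying.Adj a b := fun h =>
    (underlying_adj.1 h).2.elim (fun h => hab (.of_adj h)) fun h => hba (.of_adj h)
  set B := D.bypass x a b with hB
  set C : Set V := {w | w ∈ B ∧ D.underlying.LinkedIn B w v} with hC
  obtain ⟨q, g, hg⟩ := (huv.linkedIn_component).exists_isChordlessPath ⟨hv, .refl⟩
    (hD.underlying_adj_of_adj hua).symm (hD.underlying_adj_of_adj hvb) hne (fun h => h.1.1 hb)
  obtain ⟨s, hs, hsa, hsx⟩ := exists_adj_betweenPaths hD ha hab hba hb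
  obtain ⟨t, ht, htb, htx⟩ := exists_adj_betweenPaths hD hb hba hab ha
  rw [betweenPaths_comm] at ht htx
  have hst : D.underlying.LinkedIn (D.betweenPaths x a b) s t :=
    Relation.ReflTransGen.trans hsx htx.symm
  obtain ⟨p, f, hf⟩ := hst.exists_isChordlessPath ht
    (hD.underlying_adj_of_adj hsa).symm (hD.underlying_adj_of_adj htb) hne (fun h => h.2.2.2 rfl)
  have two_le : ∀ {S : Set V} {l : ℕ} {h : ℕ → V},
      D.underlying.IsChordlessPath S a b l h → 2 ≤ l := by
    intro S l h hl
    by_contra hlt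
    obtain rfl | rfl : l = 0 ∨ l = 1 := by omega
    · exact hne (hl.start.symm.trans hl.finish)
    · have := hl.step 0 one_pos
      rw [hl.start, zero_add, hl.finish] at this
      exact hnadj this
  have hp := two_le hf
  have hq2 := two_le hg
  -- edges between the bypass and descendants of `x` are directed towards the latter
  have dir : ∀ {y w : V}, D.Reaches x y → w ∈ B → D.underlying.Adj y w → D.Adj w y := by
    intro y w hy hw h
    exact (underlying_adj.1 h).2.resolve_left fun h => hw.1 (hy.trans (.of_adj h))
  -- the neighbours of `a` and `b` on the bypass reach `a` and `b`, respectively, and a bypass with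
  -- at most two interior vertices would contain a vertex that reaches both
  have hq : 4 ≤ q := by
    have h1 : D.Adj (g 1) a := by
      have := hg.step 0 (by omega)
      rw [hg.start] at this
      exact dir ha (hg.mem 1 one_pos (by omega)).1 this
    have h2 : D.Adj (g (q - 1)) b := by
      have := hg.step (q - 1) (by omega)
      rw [show q - 1 + 1 = q by omega, hg.finish] at this
      exact dir hb (hg.mem (q - 1) (by omega) (by omega)).1 this.symm
    have m1 := (hg.mem 1 one_pos (by omega)).1
    by_contra hlt
    obtain rfl | rfl : q = 2 ∨ q = 3 := by omega
    · exact m1.2 ⟨.of_adj h1, .of_adj h2⟩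
    · have m2 := (hg.mem 2 two_pos (by omega)).1
      rcases (underlying_adj.1 (hg.step 1 (by omega))).2 with h | h
      · exact m1.2 ⟨.of_adj h1, .trans (.of_adj h) (.of_adj h2)⟩
      · exact m2.2 ⟨.trans (.of_adj h) (.of_adj h1), .of_adj h2⟩
  refine hno (p + q) (by omega) (hf.cycleGraph_isIndContained hg hp hq2 ?_ ?_)
  · exact Set.disjoint_left.2 fun y hy hy' => hy'.1.1 hy.1
  · -- an edge between the two paths allows to replace `a` or `b` by an ancestor
    rintro y ⟨hxy, hy, hya, hyb⟩ w ⟨hw, hwv⟩ hadj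
    have hwy := dir hxy hw hadj
    rcases hy with hy | hy
    · have hsub : B ⊆ D.bypass x y b := bypass_subset hy .refl
      exact iha y (hy.transGen hya) b
        ⟨hxy, hb, w, hsub hw, v, hsub hv, .of_adj hwy, .of_adj hvb, hwv.mono hsub⟩
    · have hsub : B ⊆ D.bypass x a y := bypass_subset .refl hy
      refine ihb y (hy.transGen hyb)
        ⟨ha, hxy, u, hsub hu, w, hsub hw, .of_adj hua, .of_adj hwy, ?_⟩
      exact SimpleGraph.LinkedIn.mono hsub (Relation.ReflTransGen.trans huv hwv.symm)

end Digraph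

/-! ### Dominating sets and the flattening -/

/-- Let `R` be the incidence relation of a set system (`R x y`: the set `x` contains the point `y`).
The hypothesis `hR` excludes cycles: for points `a` and `b` of a set `x₀`, a chain of sets that
leads from a set containing `a` to a set containing `b`, and in which consecutive sets share a point
outside `x₀`, has a member containing both `a` and `b`. Then, unless `x₀` contains all points of the
sets in `𝒳`, there is a point outside `x₀` such that some set containing it includes all sets
containing it. The induction passes to the sets linked to each other outside `x₀`, with the one that
has the largest trace on `x₀` in the role of `x₀`. -/
theorem exists_dominating_set_aux {X Y : Type*} [Finite Y] {R : X → Y → Prop}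
    (hR : ∀ x₀ a b u v, R x₀ a → R x₀ b → R u a → R v b → ¬ (R u a ∧ R u b) →
      ¬ Relation.ReflTransGen (fun x x' => ¬ (R x a ∧ R x b) ∧ ¬ (R x' a ∧ R x' b) ∧
        ∃ c, ¬ R x₀ c ∧ R x c ∧ R x' c) u v)
    (𝒳 : Finset X) (x₀ : X) (hx₀ : x₀ ∈ 𝒳) (h : ∃ x ∈ 𝒳, ∃ y, R x y ∧ ¬ R x₀ y) :
    ∃ y, ¬ R x₀ y ∧ ∃ x ∈ 𝒳, R x y ∧ ∀ x' ∈ 𝒳, R x' y → ∀ y', R x' y' → R x y' := by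
  classical
  induction 𝒳 using Finset.strongInduction generalizing x₀ with
  | H 𝒳 ih =>
  obtain ⟨z, hz, y₀, hzy, hy₀⟩ := h
  -- the sets that are linked to `z` by points outside `x₀`
  let L : X → X → Prop := fun x x' => x ∈ 𝒳 ∧ x' ∈ 𝒳 ∧ ∃ c, ¬ R x₀ c ∧ R x c ∧ R x' c
  have hLsymm : ∀ x x', L x x' → L x' x := fun x x' ⟨h1, h2, c, h3, h4, h5⟩ =>
    ⟨h2, h1, c, h3, h5, h4⟩
  let 𝒞 := 𝒳.filter fun x => Relation.ReflTransGen L z x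
  have hzC : z ∈ 𝒞 := Finset.mem_filter.2 ⟨hz, .refl⟩
  have hstep : ∀ x ∈ 𝒞, ∀ x', L x x' → x' ∈ 𝒞 := fun x hx x' h =>
    Finset.mem_filter.2 ⟨h.2.1, (Finset.mem_filter.1 hx).2.tail h⟩
  have hx₀C : x₀ ∉ 𝒞 := by
    intro h
    rcases Relation.ReflTransGen.cases_tail (Finset.mem_filter.1 h).2 with
      h | ⟨x, -, -, -, c, hc, -, hc'⟩
    · exact hy₀ (h ▸ hzy)
    · exact hc hc'
  -- among these, one whose trace on `x₀` is largest contains the traces of all others: consider the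
  -- first set `x'` on a chain that starts at `x₁` whose trace is not contained in that of `x₁`
  obtain ⟨x₁, hx₁, hmax⟩ := Finset.exists_max_image 𝒞 (fun x => {y | R x y ∧ R x₀ y}.ncard)
    ⟨z, hzC⟩
  let T : X → Prop := fun x => ∀ y, R x y → R x₀ y → R x₁ y
  have hT : ∀ x ∈ 𝒞, T x := by
    have key : ∀ x, Relation.ReflTransGen L x₁ x →
        x ∈ 𝒞 ∧ T x ∧ Relation.ReflTransGen (fun x x' => L x x' ∧ T x ∧ T x') x₁ x := by
      intro x hx
      induction hx with
      | refl => exact ⟨hx₁, fun _ h _ => h, .refl⟩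
      | @tail x x' _ hxx' ih =>
        obtain ⟨hxC, hTx, hchain⟩ := ih
        have hx'C := hstep x hxC x' hxx'
        suffices hTx' : T x' from ⟨hx'C, hTx', hchain.tail ⟨hxx', hTx, hTx'⟩⟩
        by_contra hTx'
        obtain ⟨b, hb, hb₀, hb₁⟩ : ∃ b, R x' b ∧ R x₀ b ∧ ¬ R x₁ b := by
          simpa [T] using hTx'
        obtain ⟨a, ha, ha₀, ha'⟩ : ∃ a, R x₁ a ∧ R x₀ a ∧ ¬ R x' a := by
          by_contra hcon
          push Not at hcon
          refine absurd (hmax x' hx'C) (not_le.2 (Set.ncard_lt_ncard ⟨?_, ?_⟩ (Set.toFinite _)))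
          · exact fun y hy => ⟨hcon y hy.1 hy.2, hy.2⟩
          · exact fun hsub => hb₁ (hsub (a := b) ⟨hb, hb₀⟩).1
        refine hR x₀ a b x₁ x' ha₀ hb₀ ha hb (fun h => hb₁ h.2) (.tail (b := x) ?_ ?_)
        · refine Relation.ReflTransGen.mono ?_ _ _ hchain
          rintro w w' ⟨⟨_, _, hc⟩, hw, hw'⟩
          exact ⟨fun h => hb₁ (hw b h.2 hb₀), fun h => hb₁ (hw' b h.2 hb₀), hc⟩
        · exact ⟨fun h => hb₁ (hTx b h.2 hb₀), fun h => ha' h.1, hxx'.2.2⟩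
    intro x hx
    refine (key x (Relation.ReflTransGen.trans ?_ (Finset.mem_filter.1 hx).2)).2.1
    have hsymm : Std.Symm L := ⟨hLsymm⟩
    exact symm (Finset.mem_filter.1 hx₁).2
  have hclosed : ∀ x ∈ 𝒞, ∀ y, R x y → ¬ R x₀ y → ∀ x' ∈ 𝒳, R x' y → x' ∈ 𝒞 :=
    fun x hx y hxy hy x' hx' hx'y =>
      hstep x hx x' ⟨(Finset.mem_filter.1 hx).1, hx', y, hy, hxy, hx'y⟩
  by_cases hcov : ∃ x ∈ 𝒞, ∃ y, R x y ∧ ¬ R x₁ y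
  · obtain ⟨y, hy, x, hx, hxy, hdom⟩ := ih 𝒞
      ((Finset.ssubset_iff_of_subset (Finset.filter_subset _ _)).2 ⟨x₀, hx₀, hx₀C⟩) x₁ hx₁ hcov
    have hy' : ¬ R x₀ y := fun h => hy (hT x hx y hxy h)
    exact ⟨y, hy', x, (Finset.mem_filter.1 hx).1, hxy,
      fun x' hx' hx'y => hdom x' (hclosed x hx y hxy hy' x' hx' hx'y) hx'y⟩
  · push Not at hcov
    exact ⟨y₀, hy₀, x₁, (Finset.mem_filter.1 hx₁).1, hcov z hzC y₀ hzy,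
      fun x' hx' hx'y => hcov x' (hclosed z hzC y₀ hzy hy₀ x' hx' hx'y)⟩

theorem exists_dominating_set {X Y : Type*} [Finite X] [Finite Y] {R : X → Y → Prop}
    (hR : ∀ x₀ a b u v, R x₀ a → R x₀ b → R u a → R v b → ¬ (R u a ∧ R u b) →
      ¬ Relation.ReflTransGen (fun x x' => ¬ (R x a ∧ R x b) ∧ ¬ (R x' a ∧ R x' b) ∧
        ∃ c, ¬ R x₀ c ∧ R x c ∧ R x' c) u v)
    (h : ∃ x y, R x y) : ∃ x y, R x y ∧ ∀ x', R x' y → ∀ y', R x' y' → R x y' := by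
  have := Fintype.ofFinite X
  obtain ⟨x₀, y₀, h₀⟩ := h
  by_cases hcov : ∃ x ∈ (Finset.univ : Finset X), ∃ y, R x y ∧ ¬ R x₀ y
  · obtain ⟨y, -, x, -, hxy, hdom⟩ :=
      exists_dominating_set_aux hR Finset.univ x₀ (Finset.mem_univ _) hcov
    exact ⟨x, y, hxy, fun x' => hdom x' (Finset.mem_univ _)⟩
  · push Not at hcov
    exact ⟨x₀, y₀, h₀, fun x' _ => hcov x' (Finset.mem_univ _)⟩

namespace Digraph

variable {V : Type*} {D : Digraph V}

theorem IsSource.eq_of_reaches {u v : V} (hv : D.IsSource v) (h : D.Reaches u v) : u = v := by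
  rcases Relation.ReflTransGen.cases_tail h with h | ⟨w, -, hw⟩
  · exact h.symm
  · exact absurd hw (hv w)

theorem IsSink.eq_of_reaches {u v : V} (hu : D.IsSink u) (h : D.Reaches u v) : u = v := by
  rcases Relation.ReflTransGen.cases_head h with h | ⟨w, hw, -⟩
  · exact h
  · exact absurd hw (hu w)

theorem IsAcyclic.exists_source_reaches [Finite V] (hD : D.IsAcyclic) (v : V) :
    ∃ s, D.IsSource s ∧ D.Reaches s v := by
  induction v using hD.wellFounded.induction with
  | _ v ih =>
  by_cases hv : D.IsSource v
  · exact ⟨v, hv, .refl⟩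
  · obtain ⟨u, hu⟩ : ∃ u, D.Adj u v := by simpa [IsSource] using hv
    obtain ⟨s, hs, hsu⟩ := ih u (.single hu)
    exact ⟨s, hs, hsu.trans (.of_adj hu)⟩

theorem IsAcyclic.linkedIn_bypass (hD : D.IsAcyclic) {x a b w w' : V} (hw : w ∈ D.bypass x a b)
    (h : D.Reaches w w') (hx : ¬ D.Reaches x w') :
    D.underlying.LinkedIn (D.bypass x a b) w w' := by
  induction h with
  | refl => exact .refl
  | @tail y z hwy hyz ih =>
    have hy : ¬ D.Reaches x y := fun h => hx (h.trans (.of_adj hyz))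
    exact (ih hy).tail ⟨mem_bypass_of_reaches hw hwy hy,
      mem_bypass_of_reaches hw (.tail hwy hyz) hx, hD.underlying_adj_of_adj hyz⟩

/-- Every nonempty set `U` of vertices (of sinks, in the application) has an element `t` such that
one of the sources reaching `t` reaches every element of `U` that is reached by any of them. -/
theorem IsAcyclic.exists_dominating_source [Finite V] (hD : D.IsAcyclic)
    (hno : ∀ k, 6 ≤ k → ¬ (SimpleGraph.cycleGraph k).IsIndContained D.underlying) {U : Set V}
    (hne : U.Nonempty) :
    ∃ s, D.IsSource s ∧ ∃ t ∈ U, D.Reaches s t ∧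
      ∀ s', D.IsSource s' → D.Reaches s' t → ∀ t' ∈ U, D.Reaches s' t' → D.Reaches s t' := by
  have := exists_dominating_set (R := fun s t => D.IsSource s ∧ t ∈ U ∧ D.Reaches s t) ?_ ?_
  · obtain ⟨s, t, ⟨hs, ht, hst⟩, hdom⟩ := this
    exact ⟨s, hs, t, ht, hst, fun s' hs' h t' ht' h' =>
      (hdom s' ⟨hs', ht, h⟩ t' ⟨hs', ht', h'⟩).2.2⟩
  · rintro x a b u v ⟨hx, ha, hxa⟩ ⟨-, hb, hxb⟩ ⟨hu, -, hua⟩ ⟨hv, -, hvb⟩ hnot hchain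
    have hub : ¬ D.Reaches u b := fun h => hnot ⟨⟨hu, ha, hua⟩, hu, hb, h⟩
    have hxu : ¬ D.Reaches x u := fun h => hub (hu.eq_of_reaches h ▸ hxb)
    have huB : u ∈ D.bypass x a b := ⟨hxu, fun h => hub h.2⟩
    have key : v ∈ D.bypass x a b ∧ D.underlying.LinkedIn (D.bypass x a b) u v := by
      clear hvb
      induction hchain with
      | refl => exact ⟨huB, .refl⟩
      | @tail y z _ hyz ih =>
        obtain ⟨-, hz, c, hxc, ⟨hy, hc, hyc⟩, hzs, -, hzc⟩ := hyz
        obtain ⟨hyB, huy⟩ := ih hy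
        have hxc' : ¬ D.Reaches x c := fun h => hxc ⟨hx, hc, h⟩
        have hzB : z ∈ D.bypass x a b := ⟨fun h => hxc' (h.trans hzc),
          fun h => hz ⟨⟨hzs, ha, h.1⟩, hzs, hb, h.2⟩⟩
        exact ⟨hzB, Relation.ReflTransGen.trans huy (Relation.ReflTransGen.trans
          (hD.linkedIn_bypass hyB hyc hxc') (hD.linkedIn_bypass hzB hzc hxc').symm)⟩
    exact hD.not_bypassed hno x a b ⟨hxa, hxb, u, huB, v, key.1, hua, hvb, key.2⟩
  · obtain ⟨t, ht⟩ := hne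
    obtain ⟨s, hs, hst⟩ := hD.exists_source_reaches t
    exact ⟨s, t, hs, ht, hst⟩

theorem flatten_underlying_adj {u v : {v : V // D.IsSource v ∨ D.IsSink v}}
    (hu : D.IsSource u.1) :
    D.flatten.underlying.Adj u v ↔ u ≠ v ∧ D.IsSink v.1 ∧ D.Reaches u.1 v.1 := by
  rw [underlying_adj]
  refine and_congr_right fun hne => ⟨?_, fun h => .inl ⟨hu, h⟩⟩
  rintro (h | h)
  · exact h.2
  · exact absurd (Subtype.ext (hu.eq_of_reaches h.2.2)).symm hne

theorem flatten_underlying_adj' {u v : {v : V // D.IsSource v ∨ D.IsSink v}}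
    (hu : D.IsSink u.1) :
    D.flatten.underlying.Adj u v ↔ u ≠ v ∧ D.IsSource v.1 ∧ D.Reaches v.1 u.1 := by
  rw [underlying_adj]
  refine and_congr_right fun hne => ⟨?_, fun h => .inr ⟨h.1, hu, h.2⟩⟩
  rintro (h | h)
  · exact absurd (Subtype.ext (hu.eq_of_reaches h.2.2)) hne
  · exact ⟨h.1, h.2.2⟩

theorem flatten_isBipartite (D : Digraph V) : D.flatten.underlying.IsBipartite := by
  classical
  refine (SimpleGraph.Coloring.mk (fun v => decide (D.IsSource v.1)) ?_ :
    D.flatten.underlying.Coloring Bool).colorable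
  intro u v h heq
  rw [decide_eq_decide] at heq
  have hne := (underlying_adj.1 h).1
  rcases (underlying_adj.1 h).2 with h | h
  · exact hne (Subtype.ext ((heq.1 h.1).eq_of_reaches h.2.2))
  · exact hne (Subtype.ext ((heq.2 h.1).eq_of_reaches h.2.2)).symm

/-- An induced cycle of the flattening can be rotated so as to start at a source. -/
theorem exists_embedding_isSource_zero {m : ℕ}
    (φ : SimpleGraph.cycleGraph (m + 6) ↪g D.flatten.underlying) :
    ∃ ψ : SimpleGraph.cycleGraph (m + 6) ↪g D.flatten.underlying, D.IsSource (ψ 0).1 := by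
  rcases (φ 0).2 with h | h
  · exact ⟨φ, h⟩
  · refine ⟨⟨⟨fun i => φ (i + 1), fun i j hij => ?_⟩, ?_⟩, ?_⟩
    · exact add_right_cancel (φ.injective hij)
    · intro i j
      change D.flatten.underlying.Adj (φ (i + 1)) (φ (j + 1)) ↔ _
      rw [φ.map_adj_iff, SimpleGraph.cycleGraph_adj', SimpleGraph.cycleGraph_adj',
        add_sub_add_right_eq_sub, add_sub_add_right_eq_sub]
    · change D.IsSource (φ (0 + 1)).1
      have : D.flatten.underlying.Adj (φ 0) (φ (0 + 1)) := by
        rw [φ.map_adj_iff, SimpleGraph.cycleGraph_adj_iff_of_lt (by simp)]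
        simp
      exact ((flatten_underlying_adj' h).1 this).2.1

theorem IsAcyclic.flatten_isChordalBipartite [Finite V] (hD : D.IsAcyclic)
    (hno : ∀ k, 6 ≤ k → ¬ (SimpleGraph.cycleGraph k).IsIndContained D.underlying) :
    D.flatten.underlying.IsChordalBipartite := by
  refine ⟨D.flatten_isBipartite, ?_⟩
  rintro k hk ⟨φ⟩
  obtain ⟨m, rfl⟩ := Nat.exists_eq_add_of_le' hk
  obtain ⟨φ, hx⟩ := exists_embedding_isSource_zero φ
  let w : ℕ → {v : V // D.IsSource v ∨ D.IsSink v} := fun i =>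
    if h : i < m + 6 then φ ⟨i, h⟩ else φ 0
  have hw0 : w 0 = φ 0 := by simp only [w]; rw [dif_pos (by omega)]; rfl
  rw [← hw0] at hx
  have hadj : ∀ i j, i < j → j < m + 6 →
      (D.flatten.underlying.Adj (w i) (w j) ↔ j = i + 1 ∨ i = 0 ∧ j = m + 5) := by
    intro i j hij hj
    simp only [w]
    rw [dif_pos (by omega), dif_pos hj, φ.map_adj_iff,
      SimpleGraph.cycleGraph_adj_iff_of_lt (by simpa using hij)]
    simp
  have hinj : ∀ i j, i < j → j < m + 6 → w i ≠ w j := by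
    intro i j hij hj h
    simp only [w] at h
    rw [dif_pos (by omega), dif_pos hj] at h
    have := φ.injective h
    simp at this
    omega
  -- the rest of the cycle bypasses the source `w 0` and its neighbours `w 1` and `w (m + 5)`
  obtain ⟨-, ha, hxa⟩ := (flatten_underlying_adj hx).1
    ((hadj 0 1 (by omega) (by omega)).2 (by simp))
  obtain ⟨-, hb, hxb⟩ := (flatten_underlying_adj hx).1
    ((hadj 0 (m + 5) (by omega) (by omega)).2 (by simp))
  obtain ⟨-, hu, hua⟩ := (flatten_underlying_adj' ha).1
    ((hadj 1 2 (by omega) (by omega)).2 (by simp))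
  obtain ⟨-, hv, hvb⟩ := (flatten_underlying_adj' hb).1
    ((hadj (m + 4) (m + 5) (by omega) (by omega)).2 (by simp)).symm
  have hB : ∀ i, 2 ≤ i → i ≤ m + 4 → (w i).1 ∈ D.bypass (w 0).1 (w 1).1 (w (m + 5)).1 := by
    intro i h2 hi
    refine ⟨fun h => ?_, fun h => ?_⟩
    · rcases (w i).2 with hs | hs
      · exact hinj 0 i (by omega) (by omega) (Subtype.ext (hs.eq_of_reaches h))
      · have := (hadj 0 i (by omega) (by omega)).1
          ((flatten_underlying_adj hx).2 ⟨hinj 0 i (by omega) (by omega), hs, h⟩)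
        omega
    · rcases (w i).2 with hs | hs
      · have h1 := (hadj 1 i (by omega) (by omega)).1
          ((flatten_underlying_adj' ha).2 ⟨hinj 1 i (by omega) (by omega), hs, h.1⟩)
        have h2 := (hadj i (m + 5) (by omega) (by omega)).1
          ((flatten_underlying_adj hs).2 ⟨hinj i _ (by omega) (by omega), hb, h.2⟩)
        omega
      · exact hinj 1 i (by omega) (by omega) (Subtype.ext (hs.eq_of_reaches h.1)).symm
  have hlink : ∀ i, i ≤ m + 2 → D.underlying.LinkedIn (D.bypass (w 0).1 (w 1).1 (w (m + 5)).1)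
      (w 2).1 (w (i + 2)).1 := by
    intro i
    induction i with
    | zero => intro; exact .refl
    | succ i ih =>
      intro hi
      have h1 := hB (i + 2) (by omega) (by omega)
      have h2 := hB (i + 1 + 2) (by omega) (by omega)
      have := (underlying_adj.1 ((hadj (i + 2) (i + 1 + 2) (by omega) (by omega)).2 (by omega))).2
      refine (ih (by omega)).trans ?_
      rcases this with h | h
      · exact hD.linkedIn_bypass h1 h.2.2 h2.1
      · exact (hD.linkedIn_bypass h2 h.2.2 h1.1).symm
  exact hD.not_bypassed hno _ _ _ ⟨hxa, hxb, _, hB 2 (by omega) (by omega), _,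
    hB (m + 4) (by omega) (by omega), hua, hvb, hlink (m + 2) (by omega)⟩

end Digraph

/-! ### Programs with counting loops -/

namespace RAM

/-- Programs whose only loops are counting loops: `forVar x c` executes `c` with
`x = 0, 1, …, n - 1`, where `n` is the content of register `0`. -/
inductive Prog : Type
  | skip
  | assign (x : ℕ) (e : Expr)
  | store (a : ℕ) (i e : Expr)
  | seq (c d : Prog)
  | ite (e : Expr) (c d : Prog)
  | forVar (x : ℕ) (c : Prog)

namespace Prog

/-- The translation into the language of while-programs. -/
def compile : Prog → Cmd
  | skip => .skip
  | assign x e => .assign x e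
  | store a i e => .store a i e
  | seq c d => .seq c.compile d.compile
  | ite e c d => .ite e c.compile d.compile
  | forVar x c => .seq (.assign x (.lit 0))
      (.loop (.sub (.var 0) (.var x)) (.seq c.compile (.assign x (.add (.var x) (.lit 1)))))

/-- The memory after the execution. -/
def run : Prog → State → State
  | skip, s => s
  | assign x e, s => s.setVar x (e.eval s)
  | store a i e, s => s.setArr a (i.eval s) (e.eval s)
  | seq c d, s => d.run (c.run s)
  | ite e c d, s => if e.eval s ≠ 0 then c.run s else d.run s
  | forVar x c, s => Nat.rec (s.setVar x 0) (fun i s' => (c.run s').setVar x (i + 1)) (s.var 0)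

/-- Whether the program may write to the register `y`. -/
def assigns (y : ℕ) : Prog → Bool
  | skip => false
  | assign x _ => x == y
  | store _ _ _ => false
  | seq c d => c.assigns y || d.assigns y
  | ite _ c d => c.assigns y || d.assigns y
  | forVar x c => x == y || c.assigns y

/-- Whether the program may write to the array `b`. -/
def stores (b : ℕ) : Prog → Bool
  | skip => false
  | assign _ _ => false
  | store a _ _ => a == b
  | seq c d => c.stores b || d.stores b
  | ite _ c d => c.stores b || d.stores b
  | forVar _ c => c.stores b

/-- No loop body writes to the counter of its loop. -/
def wellFormed : Prog → Bool
  | skip => true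
  | assign _ _ => true
  | store _ _ _ => true
  | seq c d => c.wellFormed && d.wellFormed
  | ite _ c d => c.wellFormed && d.wellFormed
  | forVar x c => !c.assigns x && c.wellFormed

open Polynomial in
/-- A bound for the number of steps, as a polynomial in the content of register `0`. -/
noncomputable def time : Prog → ℕ[X]
  | skip => 1
  | assign _ e => C (e.cost + 1)
  | store _ i e => C (i.cost + e.cost + 1)
  | seq c d => c.time + d.time
  | ite e c d => C (e.cost + 1) + c.time + d.time
  | forVar _ c => X * (c.time + C 8) + C 6

theorem run_var {y : ℕ} (c : Prog) (s : State) (h : c.assigns y = false) :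
    (c.run s).var y = s.var y := by
  induction c generalizing s with
  | skip => rfl
  | assign x e =>
    have : y ≠ x := by rintro rfl; simp [assigns] at h
    simp [run, State.setVar, this]
  | store => rfl
  | seq c d ihc ihd =>
    simp only [assigns, Bool.or_eq_false_iff] at h
    simp [run, ihc _ h.1, ihd _ h.2]
  | ite e c d ihc ihd =>
    simp only [assigns, Bool.or_eq_false_iff] at h
    simp only [run]
    split_ifs
    · exact ihc _ h.1
    · exact ihd _ h.2
  | forVar x c ih =>
    simp only [assigns, Bool.or_eq_false_iff, beq_eq_false_iff_ne] at h
    simp only [run]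
    generalize s.var 0 = n
    induction n with
    | zero => simp [State.setVar, h.1.symm]
    | succ n ihn => simpa [State.setVar, h.1.symm, ih _ h.2] using ihn

theorem run_arr {a : ℕ} (c : Prog) (s : State) (h : c.stores a = false) :
    (c.run s).arr a = s.arr a := by
  induction c generalizing s with
  | skip => rfl
  | assign => rfl
  | store b i e =>
    have : a ≠ b := by rintro rfl; simp [stores] at h
    simp [run, State.setArr, this]
  | seq c d ihc ihd =>
    simp only [stores, Bool.or_eq_false_iff] at h
    simp [run, ihc _ h.1, ihd _ h.2]
  | ite e c d ihc ihd =>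
    simp only [stores, Bool.or_eq_false_iff] at h
    simp only [run]
    split_ifs
    · exact ihc _ h.1
    · exact ihd _ h.2
  | forVar x c ih =>
    simp only [stores] at h
    simp only [run]
    generalize s.var 0 = n
    induction n with
    | zero => rfl
    | succ n ihn => simpa [State.setVar, ih _ h] using ihn

/-- Invariant rule for counting loops. Whatever the body does not write keeps its value. -/
theorem run_forVar_induction {x : ℕ} {c : Prog} {s : State} (Inv : ℕ → State → Prop)
    (init : Inv 0 (s.setVar x 0))
    (step : ∀ i < s.var 0, ∀ s', s'.var x = i →
      (∀ y, (forVar x c).assigns y = false → s'.var y = s.var y) →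
      (∀ a, c.stores a = false → s'.arr a = s.arr a) →
      Inv i s' → Inv (i + 1) ((c.run s').setVar x (i + 1))) :
    Inv (s.var 0) ((forVar x c).run s) := by
  have key : ∀ m ≤ s.var 0, ∀ s', s' = (Nat.rec (s.setVar x 0)
      (fun i s' => (c.run s').setVar x (i + 1)) m : State) → s'.var x = m ∧
      (∀ y, (forVar x c).assigns y = false → s'.var y = s.var y) ∧
      (∀ a, c.stores a = false → s'.arr a = s.arr a) ∧ Inv m s' := by
    intro m
    induction m with
    | zero =>
      rintro - s' rfl
      refine ⟨by simp [State.setVar], fun y hy => ?_, fun _ _ => rfl, init⟩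
      simp only [assigns, Bool.or_eq_false_iff, beq_eq_false_iff_ne] at hy
      simp [State.setVar, hy.1.symm]
    | succ m ih =>
      rintro hm s' rfl
      obtain ⟨h1, h2, h3, h4⟩ := ih (by omega) _ rfl
      refine ⟨by simp [State.setVar], fun y hy => ?_, fun a ha => ?_,
        step m hm _ h1 h2 h3 h4⟩
      · have hy' := hy
        simp only [assigns, Bool.or_eq_false_iff, beq_eq_false_iff_ne] at hy'
        rw [← h2 y hy]
        simp [State.setVar, hy'.1.symm, run_var c _ hy'.2]
      · exact (run_arr c _ ha).trans (h3 a ha)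
  exact (key _ le_rfl _ rfl).2.2.2

theorem exec_compile (c : Prog) (hc : c.wellFormed) (h0 : c.assigns 0 = false) (s : State) :
    ∃ t, Exec c.compile s (c.run s) t ∧ t ≤ c.time.eval (s.var 0) := by
  induction c generalizing s with
  | skip => exact ⟨_, .skip s, by simp [time]⟩
  | assign x e => exact ⟨_, .assign s x e, by simp [time]⟩
  | store a i e => exact ⟨_, .store s a i e, by simp [time]⟩
  | seq c d ihc ihd =>
    simp only [assigns, Bool.or_eq_false_iff] at h0
    simp only [wellFormed, Bool.and_eq_true] at hc
    obtain ⟨t, ht, hle⟩ := ihc hc.1 h0.1 s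
    obtain ⟨t', ht', hle'⟩ := ihd hc.2 h0.2 (c.run s)
    rw [run_var c s h0.1] at hle'
    exact ⟨_, .seq ht ht', by simpa [time] using add_le_add hle hle'⟩
  | ite e c d ihc ihd =>
    simp only [assigns, Bool.or_eq_false_iff] at h0
    simp only [wellFormed, Bool.and_eq_true] at hc
    by_cases he : e.eval s = 0
    · obtain ⟨t, ht, hle⟩ := ihd hc.2 h0.2 s
      refine ⟨_, by simpa [run, compile, he] using Exec.ite_false he ht, ?_⟩
      simp only [time, Polynomial.eval_add, Polynomial.eval_C]
      omega
    · obtain ⟨t, ht, hle⟩ := ihc hc.1 h0.1 s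
      refine ⟨_, by simpa [run, compile, he] using Exec.ite_true he ht, ?_⟩
      simp only [time, Polynomial.eval_add, Polynomial.eval_C]
      omega
  | forVar x c ih =>
    simp only [wellFormed, Bool.and_eq_true, Bool.not_eq_true'] at hc
    have h0' := h0
    simp only [assigns, Bool.or_eq_false_iff, beq_eq_false_iff_ne] at h0'
    let st : ℕ → State := fun m =>
      Nat.rec (s.setVar x 0) (fun i s' => (c.run s').setVar x (i + 1)) m
    have hx : ∀ m, (st m).var x = m := by
      rintro (_ | m) <;> simp [st, State.setVar]
    have hst0 : ∀ m, (st m).var 0 = s.var 0 := by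
      intro m
      induction m with
      | zero => simp [st, State.setVar, h0'.1.symm]
      | succ m ihm =>
        rw [← ihm, ← run_var c (st m) h0'.2]
        simp [st, State.setVar, h0'.1.symm]
    set T := c.time.eval (s.var 0) with hT
    have hloop : ∀ j m, m + j = s.var 0 → ∃ t,
        Exec (.loop (.sub (.var 0) (.var x))
          (.seq c.compile (.assign x (.add (.var x) (.lit 1))))) (st m) (st (s.var 0)) t ∧
        t ≤ j * (T + 8) + 4 := by
      intro j
      induction j with
      | zero =>
        rintro m hm
        obtain rfl : m = s.var 0 := by omega
        exact ⟨_, .loop_done (by simp [Expr.eval, hx, hst0]), by simp [Expr.cost]⟩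
      | succ j ihj =>
        intro m hm
        obtain ⟨t, ht, hle⟩ := ih hc.2 h0'.2 (st m)
        rw [hst0] at hle
        obtain ⟨t', ht', hle'⟩ := ihj (m + 1) (by omega)
        have hassign := Exec.assign (c.run (st m)) x (.add (.var x) (.lit 1))
        have : (c.run (st m)).setVar x (Expr.eval (c.run (st m)) (.add (.var x) (.lit 1))) =
            st (m + 1) := by
          simp [st, Expr.eval, run_var c _ hc.1, hx m]
        rw [this] at hassign
        refine ⟨_, .loop_step ?_ (.seq ht hassign) ht', ?_⟩
        · simp only [Expr.eval, hx, hst0]; omega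
        · simp only [Expr.cost]
          rw [Nat.add_mul, one_mul]
          omega
    obtain ⟨t, ht, hle⟩ := hloop (s.var 0) 0 (by omega)
    refine ⟨_, .seq (.assign s x (.lit 0)) ht, ?_⟩
    simp only [time, Expr.cost, Polynomial.eval_add, Polynomial.eval_mul, Polynomial.eval_X,
      Polynomial.eval_C, ← hT]
    omega

end Prog

end RAM

/-! ### Exchange argument and paths with bounded interior -/

namespace Digraph

variable {V : Type*} {D : Digraph V}

/-- The sinks that are not reachable from `C`. -/
def uncovered (D : Digraph V) (C : Finset V) : Set V :=
  {t | D.IsSink t ∧ ∀ s ∈ C, ¬ D.Reaches s t}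

/-- The source `s` reaches `t ∈ U`, and it reaches all elements of `U` that are reached by any
source that reaches `t`. -/
def Dominates (D : Digraph V) (U : Set V) (s t : V) : Prop :=
  D.IsSource s ∧ t ∈ U ∧ D.Reaches s t ∧
    ∀ s', D.IsSource s' → D.Reaches s' t → ∀ t' ∈ U, D.Reaches s' t' → D.Reaches s t'

theorem Dominates.anti {U U' : Set V} {s t : V} (h : D.Dominates U s t) (hU : U' ⊆ U)
    (ht : t ∈ U') : D.Dominates U' s t :=
  ⟨h.1, ht, h.2.2.1, fun s' hs' hs't t' ht' => h.2.2.2 s' hs' hs't t' (hU ht')⟩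

/-- Every source cover can be exchanged for one that is not larger and contains `C`. -/
structure IsExtendable (D : Digraph V) (C : Finset V) : Prop where
  isSource : ∀ s ∈ C, D.IsSource s
  exists_cover : ∀ T, D.IsSourceCover T →
    ∃ T', D.IsSourceCover T' ∧ C ⊆ T' ∧ T'.card ≤ T.card

theorem isExtendable_empty : D.IsExtendable ∅ :=
  ⟨by simp, fun T hT => ⟨T, hT, by simp, le_rfl⟩⟩

/-- A dominating source may be exchanged for any member of a cover that covers `t`. -/
theorem IsExtendable.insert [DecidableEq V] {C : Finset V} (hC : D.IsExtendable C) {s t : V}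
    (h : D.Dominates (D.uncovered C) s t) : D.IsExtendable (insert s C) := by
  obtain ⟨hs, ht, hst, hdom⟩ := h
  refine ⟨fun s' hs' => ?_, fun T hT => ?_⟩
  · rcases Finset.mem_insert.1 hs' with rfl | hs'
    · exact hs
    · exact hC.isSource s' hs'
  obtain ⟨T', hT', hCT', hcard⟩ := hC.exists_cover T hT
  obtain ⟨r, hr, hrt⟩ := hT'.2 t ht.1
  have hrC : r ∉ C := fun h => ht.2 r h hrt
  refine ⟨Insert.insert s (T'.erase r), ⟨fun s' hs' => ?_, fun t' ht' => ?_⟩, ?_, ?_⟩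
  · rcases Finset.mem_insert.1 hs' with rfl | hs'
    · exact hs
    · exact hT'.1 s' (Finset.mem_of_mem_erase hs')
  · by_cases hcov : ∃ c ∈ C, D.Reaches c t'
    · obtain ⟨c, hc, hct'⟩ := hcov
      exact ⟨c, Finset.mem_insert_of_mem (Finset.mem_erase.2 ⟨fun h => hrC (h ▸ hc), hCT' hc⟩),
        hct'⟩
    · push Not at hcov
      obtain ⟨q, hq, hqt'⟩ := hT'.2 t' ht'
      by_cases hqr : q = r
      · subst hqr
        exact ⟨s, Finset.mem_insert_self _ _, hdom q (hT'.1 q hq) hrt t' ⟨ht', hcov⟩ hqt'⟩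
      · exact ⟨q, Finset.mem_insert_of_mem (Finset.mem_erase.2 ⟨hqr, hq⟩), hqt'⟩
  · refine Finset.insert_subset_insert s fun c hc => Finset.mem_erase.2 ⟨?_, hCT' hc⟩
    exact fun h => hrC (h ▸ hc)
  · have h1 := Finset.card_insert_le s (T'.erase r)
    have h2 := Finset.card_erase_add_one hr
    omega

theorem IsExtendable.isMinimumSourceCover {C : Finset V} (hC : D.IsExtendable C)
    (h : D.uncovered C = ∅) : D.IsMinimumSourceCover C := by
  refine ⟨⟨hC.isSource, fun t ht => ?_⟩, fun T hT => ?_⟩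
  · by_contra hcon
    push Not at hcon
    exact (h ▸ (⟨ht, hcon⟩ : t ∈ D.uncovered C) : t ∈ (∅ : Set V))
  · obtain ⟨T', -, hCT', hcard⟩ := hC.exists_cover T hT
    exact (Finset.card_le_card hCT').trans hcard

theorem mem_uncovered_insert [DecidableEq V] {C : Finset V} {s t : V} :
    t ∈ D.uncovered (insert s C) ↔ t ∈ D.uncovered C ∧ ¬ D.Reaches s t := by
  simp only [uncovered, Set.mem_ofPred_eq, Finset.mem_insert, forall_eq_or_imp]
  tauto

theorem isSource_iff_forall_reaches {v : V} (hD : D.IsAcyclic) :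
    D.IsSource v ↔ ∀ u, u ≠ v → ¬ D.Reaches u v :=
  ⟨fun h _ hne hu => hne (h.eq_of_reaches hu),
    fun h u hu => h u (fun e => hD v (.single (e ▸ hu))) (.of_adj hu)⟩

theorem isSink_iff_forall_reaches {v : V} (hD : D.IsAcyclic) :
    D.IsSink v ↔ ∀ u, u ≠ v → ¬ D.Reaches v u :=
  ⟨fun h _ hne hu => hne (h.eq_of_reaches hu).symm,
    fun h u hu => h u (fun e => hD v (.single (e ▸ hu))) (.of_adj hu)⟩

end Digraph

/-- There is a directed path whose interior vertices are all below `k`. -/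
inductive PathBelow {n : ℕ} (r : Fin n → Fin n → Prop) (k : ℕ) : Fin n → Fin n → Prop
  | refl (i) : PathBelow r k i i
  | single {i j} : r i j → PathBelow r k i j
  | trans {i j} (m : Fin n) : (m : ℕ) < k → PathBelow r k i m → PathBelow r k m j →
      PathBelow r k i j

theorem PathBelow.succ {n k : ℕ} {r : Fin n → Fin n → Prop} {m i j : Fin n} (hm : (m : ℕ) = k)
    (h : PathBelow r (k + 1) i j) :
    PathBelow r k i j ∨ (PathBelow r k i m ∧ PathBelow r k m j) := by
  induction h with
  | refl i => exact .inl (.refl i)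
  | single h => exact .inl (.single h)
  | trans l hl _ _ ih ih' =>
    rcases Nat.lt_succ_iff_lt_or_eq.1 hl with hl | hl
    · rcases ih with ih | ⟨ih1, ih2⟩ <;> rcases ih' with ih' | ⟨ih1', ih2'⟩
      · exact .inl (.trans l hl ih ih')
      · exact .inr ⟨.trans l hl ih ih1', ih2'⟩
      · exact .inr ⟨ih1, .trans l hl ih2 ih'⟩
      · exact .inr ⟨ih1, ih2'⟩
    · obtain rfl : l = m := Fin.ext (hl.trans hm.symm)
      exact .inr ⟨ih.elim id fun h => h.1, ih'.elim id fun h => h.2⟩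

theorem pathBelow_of_reflTransGen {n : ℕ} {r : Fin n → Fin n → Prop} {i j : Fin n}
    (h : Relation.ReflTransGen r i j) : PathBelow r n i j := by
  induction h with
  | refl => exact .refl i
  | tail _ h ih => exact .trans _ (Fin.is_lt _) ih (.single h)

/-! ### Matrices in memory -/

namespace RAM

open Prog

theorem mul_add_inj {n i j i' j' : ℕ} (hj : j < n) (hj' : j' < n) :
    i * n + j = i' * n + j' ↔ i = i' ∧ j = j' := by
  refine ⟨fun h => ?_, fun ⟨h, h'⟩ => by rw [h, h']⟩
  have hn : 0 < n := by omega
  have h1 := congrArg (· / n) h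
  have h2 := congrArg (· % n) h
  simp only [Nat.mul_comm _ n, Nat.mul_add_div hn, Nat.mul_add_mod, Nat.div_eq_of_lt hj,
    Nat.div_eq_of_lt hj', Nat.mod_eq_of_lt hj, Nat.mod_eq_of_lt hj'] at h1 h2
  exact ⟨by omega, h2⟩

theorem forall_lt_succ {n i : ℕ} (hi : i < n) {P : Fin n → Prop} :
    (∀ p : Fin n, (p : ℕ) < i + 1 → P p) ↔ (∀ p : Fin n, (p : ℕ) < i → P p) ∧ P ⟨i, hi⟩ := by
  refine ⟨fun h => ⟨fun p hp => h p (by omega), h ⟨i, hi⟩ (Nat.lt_succ_self i)⟩, ?_⟩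
  rintro ⟨h, h'⟩ p hp
  rcases Nat.lt_succ_iff_lt_or_eq.1 hp with hp | rfl
  · exact h p hp
  · exact h'

/-- Array `3` holds the offsets of the rows of an `n × n` matrix. -/
def RowOffsets (n : ℕ) (s : State) : Prop := ∀ i < n, s.arr 3 i = i * n

/-- The index of the matrix entry whose row and column are the contents of registers `x` and `y`. -/
def entryIdx (x y : ℕ) : Expr := .add (.get 3 (.var x)) (.var y)

/-- The entry of the matrix in array `0` whose row and column are the contents of registers `x`
and `y`. -/
def entry (x y : ℕ) : Expr := .get 0 (entryIdx x y)

theorem eval_entryIdx {n x y : ℕ} {s : State} (hs : RowOffsets n s) (hx : s.var x < n) :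
    (entryIdx x y).eval s = s.var x * n + s.var y := by
  simp [entryIdx, Expr.eval, hs _ hx]

theorem eval_entry {n x y : ℕ} {s : State} (hs : RowOffsets n s) (hx : s.var x < n) :
    (entry x y).eval s = s.arr 0 (s.var x * n + s.var y) := by
  rw [entry, Expr.eval, eval_entryIdx hs hx]

theorem setVar_arr (s : State) (x v : ℕ) : (s.setVar x v).arr = s.arr := rfl

theorem setVar_var (s : State) (x v y : ℕ) :
    (s.setVar x v).var y = if y = x then v else s.var y := by
  simp [State.setVar, Function.update_apply]

theorem setArr_var (s : State) (a i v : ℕ) : (s.setArr a i v).var = s.var := rfl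

theorem setArr_arr (s : State) (a i v b j : ℕ) :
    (s.setArr a i v).arr b j = if b = a ∧ j = i then v else s.arr b j := by
  by_cases hb : b = a
  · subst hb; simp [State.setArr, Function.update_apply]
  · simp [State.setArr, hb]

/-! ### Initialization -/

/-- Treat the row in register `1`; register `9` holds its offset. -/
def initStep : Prog :=
  .seq (.store 3 (.var 1) (.var 9))
    (.seq (.store 0 (.add (.var 9) (.var 1)) (.lit 1)) (.assign 9 (.add (.var 9) (.var 0))))

/-- Compute the offsets of the rows and set the diagonal of the matrix to `1`. -/
def initProg : Prog :=
  .seq (.assign 9 (.lit 0)) (.forVar 1 initStep)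

theorem initProg_run {n : ℕ} {s : State} (hn : s.var 0 = n) :
    RowOffsets n (initProg.run s) ∧ ∀ i j : Fin n,
      (initProg.run s).arr 0 (i * n + j) ≠ 0 ↔ i = j ∨ s.arr 0 (i * n + j) ≠ 0 := by
  set s₀ := s.setVar 9 0 with hs₀
  have hn₀ : s₀.var 0 = n := hn
  have := run_forVar_induction (s := s₀) (x := 1) (c := initStep)
    (fun k s' => s'.var 9 = k * n ∧ (∀ i < k, s'.arr 3 i = i * n) ∧ ∀ i j : Fin n,
      s'.arr 0 (i * n + j) ≠ 0 ↔ (i = j ∧ (i : ℕ) < k) ∨ s.arr 0 (i * n + j) ≠ 0) ?_ ?_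
  · rw [hn₀] at this
    refine ⟨this.2.1, fun i j => ?_⟩
    have h := this.2.2 i j
    rw [and_iff_left i.2] at h
    exact h
  · simp [setVar_var, setVar_arr, hs₀]
  · rintro k hk s' h1 hv - ⟨h9, h3, h0⟩
    rw [hn₀] at hk
    have hv0 : s'.var 0 = n := (hv 0 rfl).trans hn₀
    simp only [initStep, run, Expr.eval, setVar_var, setVar_arr, setArr_var, setArr_arr, h1, h9,
      hv0]
    refine ⟨by simp [Nat.add_mul], fun i hi => ?_, fun i j => ?_⟩
    · rcases Nat.lt_succ_iff_lt_or_eq.1 hi with hi | rfl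
      · simp [hi.ne, h3 i hi]
      · simp
    · simp only [mul_add_inj j.2 hk]
      have h0' := h0 i j
      by_cases hij : (i : ℕ) = k ∧ (j : ℕ) = k
      · have : i = j := Fin.ext (by omega)
        simp [hij, this]
      · have : (i = j ∧ (i : ℕ) < k + 1) ↔ (i = j ∧ (i : ℕ) < k) := by
          rw [Fin.ext_iff]; omega
        rw [this]
        simpa [hij] using h0'

/-! ### Transitive closure -/

/-- Update the entry of the pair in registers `1`, `2` by way of the vertex in register `3`. -/
def closureStep : Prog :=
  .ite (entry 1 3) (.ite (entry 3 2) (.store 0 (entryIdx 1 2) (.lit 1)) .skip) .skip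

/-- Warshall's algorithm on the matrix in array `0`. -/
def closureProg : Prog :=
  .forVar 3 (.forVar 1 (.forVar 2 closureStep))

/-- The invariant of Warshall's algorithm when the interior vertices below `k` have been processed
and, for `k` itself, the pairs `(p, q)` lexicographically below `(i, j)`. -/
def ClosureInv {n : ℕ} (r : Fin n → Fin n → Prop) (k i j : ℕ) (m : ℕ → ℕ) : Prop :=
  (∀ p q : Fin n, m (p * n + q) ≠ 0 → Relation.ReflTransGen r p q) ∧
  (∀ p q : Fin n, PathBelow r k p q → m (p * n + q) ≠ 0) ∧
  ∀ p q : Fin n, ((p : ℕ) < i ∨ ((p : ℕ) = i ∧ (q : ℕ) < j)) → PathBelow r (k + 1) p q →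
    m (p * n + q) ≠ 0

theorem closureProg_run {n : ℕ} {s : State} (hn : s.var 0 = n) (hrow : RowOffsets n s)
    {r : Fin n → Fin n → Prop} (hr : ∀ i j : Fin n, s.arr 0 (i * n + j) ≠ 0 ↔ i = j ∨ r i j)
    (i j : Fin n) :
    (closureProg.run s).arr 0 (i * n + j) ≠ 0 ↔ Relation.ReflTransGen r i j := by
  have := run_forVar_induction (s := s) (x := 3) (c := .forVar 1 (.forVar 2 closureStep))
    (fun k s' => ClosureInv r k 0 0 (s'.arr 0)) ?_ ?_
  · rw [hn] at this
    exact ⟨this.1 i j, fun h => this.2.1 i j (pathBelow_of_reflTransGen h)⟩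
  · rw [setVar_arr]
    refine ⟨fun p q h => ?_, fun p q h => ?_, fun p q h => by omega⟩
    · rcases (hr p q).1 h with rfl | h
      · exact .refl
      · exact .single h
    · refine (hr p q).2 ?_
      induction h with
      | refl => exact .inl rfl
      | single h => exact .inr h
      | trans m hm => omega
  intro k hk s₁ hk₁ hv₁ ha₁ inv₁
  have := run_forVar_induction (s := s₁) (x := 1) (c := .forVar 2 closureStep)
    (fun i s' => ClosureInv r k i 0 (s'.arr 0)) inv₁ ?_
  · rw [hv₁ 0 rfl, hn] at this
    exact ⟨this.1, fun p q => this.2.2 p q (.inl p.2), fun p q h => by omega⟩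
  intro i hi s₂ hi₂ hv₂ ha₂ inv₂
  have := run_forVar_induction (s := s₂) (x := 2) (c := closureStep)
    (fun j s' => ClosureInv r k i j (s'.arr 0)) inv₂ ?_
  · rw [hv₂ 0 rfl, hv₁ 0 rfl, hn] at this
    refine ⟨this.1, this.2.1, fun p q h => this.2.2 p q ?_⟩
    have := q.2
    omega
  intro j hj s₃ hj₃ hv₃ ha₃ inv₃
  rw [hn] at hk
  rw [hv₁ 0 rfl, hn] at hi
  rw [hv₂ 0 rfl, hv₁ 0 rfl, hn] at hj
  have hrow₃ : RowOffsets n s₃ := by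
    intro l hl
    rw [ha₃ 3 rfl, ha₂ 3 rfl, ha₁ 3 rfl, hrow l hl]
  have hi₃ : s₃.var 1 = i := (hv₃ 1 rfl).trans hi₂
  have hk₃ : s₃.var 3 = k := by rw [hv₃ 3 rfl, hv₂ 3 rfl, hk₁]
  have e1 : (entry 1 3).eval s₃ = s₃.arr 0 (i * n + k) := by
    rw [eval_entry hrow₃ (by omega), hi₃, hk₃]
  have e2 : (entry 3 2).eval s₃ = s₃.arr 0 (k * n + j) := by
    rw [eval_entry hrow₃ (by omega), hj₃, hk₃]
  have e3 : (entryIdx 1 2).eval s₃ = i * n + j := by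
    rw [eval_entryIdx hrow₃ (by omega), hj₃, hi₃]
  obtain ⟨hsound, hlow, hdone⟩ := inv₃
  have hnew : ∀ p q : Fin n, (p : ℕ) = i → (q : ℕ) = j → PathBelow r (k + 1) p q →
      s₃.arr 0 (i * n + j) ≠ 0 ∨ (s₃.arr 0 (i * n + k) ≠ 0 ∧ s₃.arr 0 (k * n + j) ≠ 0) := by
    rintro p q rfl rfl h
    rcases h.succ (m := ⟨k, hk⟩) rfl with h | ⟨h, h'⟩
    · exact .inl (hlow _ _ h)
    · exact .inr ⟨hlow _ _ h, hlow _ _ h'⟩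
  simp only [closureStep, run, e1, e2, e3, setVar_arr, Expr.eval]
  by_cases hc : s₃.arr 0 (i * n + k) ≠ 0 ∧ s₃.arr 0 (k * n + j) ≠ 0
  · rw [if_pos hc.1, if_pos hc.2]
    refine ⟨fun p q h => ?_, fun p q h => ?_, fun p q hpq h => ?_⟩
    · simp only [setArr_arr, mul_add_inj q.2 hj, true_and] at h
      by_cases hpq : (p : ℕ) = i ∧ (q : ℕ) = j
      · obtain ⟨rfl, rfl⟩ := hpq
        exact (hsound p ⟨k, hk⟩ hc.1).trans (hsound ⟨k, hk⟩ q hc.2)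
      · exact hsound p q (by simpa [hpq] using h)
    · rw [setArr_arr]
      split_ifs
      · exact one_ne_zero
      · exact hlow p q h
    · simp only [setArr_arr, mul_add_inj q.2 hj, true_and]
      split_ifs with hpq'
      · exact one_ne_zero
      · exact hdone p q (by omega) h
  · have : (if s₃.arr 0 (i * n + k) ≠ 0 then if s₃.arr 0 (k * n + j) ≠ 0 then
        s₃.setArr 0 (i * n + j) 1 else s₃ else s₃) = s₃ := by
      split_ifs with h1 h2
      · exact absurd ⟨h1, h2⟩ hc
      · rfl
      · rfl
    rw [this]
    refine ⟨hsound, hlow, fun p q hpq h => ?_⟩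
    by_cases hpq' : (p : ℕ) = i ∧ (q : ℕ) = j
    · have := (hnew p q hpq'.1 hpq'.2 h).resolve_right hc
      rwa [hpq'.1, hpq'.2]
    · exact hdone p q (by omega) h

end RAM

namespace RAM

open Prog

variable {n : ℕ} {D : Digraph (Fin n)}

/-- The memory holds the number of vertices, the row offsets and the reachability matrix of `D`. -/
structure HoldsReach (D : Digraph (Fin n)) (s : State) : Prop where
  card : s.var 0 = n
  rowOffsets : RowOffsets n s
  reach : ∀ i j : Fin n, s.arr 0 (i * n + j) ≠ 0 ↔ D.Reaches i j

theorem HoldsReach.congr {s s' : State} (h : HoldsReach D s) (h0 : s'.var 0 = s.var 0)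
    (ha0 : s'.arr 0 = s.arr 0) (ha3 : s'.arr 3 = s.arr 3) : HoldsReach D s' :=
  ⟨h0.trans h.card, fun i hi => by rw [ha3, h.rowOffsets i hi], fun i j => by rw [ha0, h.reach]⟩

theorem HoldsReach.eval_entry {s : State} (h : HoldsReach D s) {x y : ℕ} {i j : Fin n}
    (hx : s.var x = i) (hy : s.var y = j) : (entry x y).eval s ≠ 0 ↔ D.Reaches i j := by
  rw [RAM.eval_entry h.rowOffsets (hx ▸ i.2), hx, hy, h.reach]

/-! ### Sources and sinks -/

/-- Compare the vertex in register `1` with the vertex in register `2`. -/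
def classifyStep : Prog :=
  .ite (.add (.sub (.var 1) (.var 2)) (.sub (.var 2) (.var 1)))
    (.seq (.ite (entry 2 1) (.store 5 (.var 1) (.lit 0)) .skip)
      (.ite (entry 1 2) (.store 4 (.var 1) (.lit 0)) .skip))
    .skip

/-- Mark the sources in array `5` and the sinks in array `4`. -/
def classifyProg : Prog :=
  .forVar 1 (.seq (.store 5 (.var 1) (.lit 1))
    (.seq (.store 4 (.var 1) (.lit 1)) (.forVar 2 classifyStep)))

open Classical in
theorem classifyStep_run {s : State} (h : HoldsReach D s) {i j : Fin n} (hi : s.var 1 = i)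
    (hj : s.var 2 = j) (a k : ℕ) :
    (classifyStep.run s).arr a k =
      if (a = 5 ∧ k = i ∧ j ≠ i ∧ D.Reaches j i) ∨ (a = 4 ∧ k = i ∧ j ≠ i ∧ D.Reaches i j) then 0
      else s.arr a k := by
  have e1 : (Expr.add (.sub (.var 1) (.var 2)) (.sub (.var 2) (.var 1))).eval s ≠ 0 ↔ j ≠ i := by
    simp only [Expr.eval, hi, hj, ne_eq, Fin.ext_iff]
    omega
  have e2 := h.eval_entry hj hi
  have e3 : ∀ v, (entry 1 2).eval (s.setArr 5 i v) ≠ 0 ↔ D.Reaches i j := fun v =>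
    (h.congr (s' := s.setArr 5 i v) rfl (by ext; simp [setArr_arr])
      (by ext; simp [setArr_arr])).eval_entry hi hj
  have e4 := h.eval_entry hi hj
  by_cases hne : j = i
  · have : ¬ (Expr.add (.sub (.var 1) (.var 2)) (.sub (.var 2) (.var 1))).eval s ≠ 0 := by
      rw [e1]; simpa
    simp only [classifyStep, run, if_neg this]
    simp [hne]
  · simp only [classifyStep, run, if_pos (e1.2 hne)]
    by_cases h1 : D.Reaches j i <;> by_cases h2 : D.Reaches i j
    all_goals
      simp only [e2, e3, e4, h1, h2, Expr.eval, setArr_arr, setArr_var, hi, if_true, if_false]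
      split_ifs <;> first | rfl | tauto

theorem classifyProg_run {s : State} (h : HoldsReach D s) (hD : D.IsAcyclic) (v : Fin n) :
    ((classifyProg.run s).arr 5 v ≠ 0 ↔ D.IsSource v) ∧
      ((classifyProg.run s).arr 4 v ≠ 0 ↔ D.IsSink v) := by
  let P : Fin n → State → Prop := fun v s' =>
    (s'.arr 5 v ≠ 0 ↔ D.IsSource v) ∧ (s'.arr 4 v ≠ 0 ↔ D.IsSink v)
  have := run_forVar_induction (s := s) (x := 1)
    (c := .seq (.store 5 (.var 1) (.lit 1))
      (.seq (.store 4 (.var 1) (.lit 1)) (.forVar 2 classifyStep)))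
    (fun k s' => ∀ v : Fin n, (v : ℕ) < k → P v s') (by simp) ?_
  · rw [h.card] at this
    exact this v v.2
  intro i hi s₁ hi₁ hv₁ ha₁ inv₁
  rw [h.card] at hi
  set s₁' := (s₁.setArr 5 i 1).setArr 4 i 1 with hs₁'
  have hrun : (Prog.seq (.store 5 (.var 1) (.lit 1))
      (.seq (.store 4 (.var 1) (.lit 1)) (.forVar 2 classifyStep))).run s₁ =
      (Prog.forVar 2 classifyStep).run s₁' := by
    simp [run, Expr.eval, setArr_var, hi₁, hs₁']
  rw [hrun]
  have h₁ : HoldsReach D s₁' := by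
    refine h.congr (hv₁ 0 rfl) ?_ ?_
    · rw [← ha₁ 0 rfl]; ext; simp [hs₁', setArr_arr]
    · rw [← ha₁ 3 rfl]; ext; simp [hs₁', setArr_arr]
  have := run_forVar_induction (s := s₁') (x := 2) (c := classifyStep)
    (fun k s' => (∀ v : Fin n, (v : ℕ) < i → P v s') ∧
      (s'.arr 5 i ≠ 0 ↔ ∀ u : Fin n, (u : ℕ) < k → u ≠ ⟨i, hi⟩ → ¬ D.Reaches u ⟨i, hi⟩) ∧
      (s'.arr 4 i ≠ 0 ↔ ∀ u : Fin n, (u : ℕ) < k → u ≠ ⟨i, hi⟩ → ¬ D.Reaches ⟨i, hi⟩ u)) ?_ ?_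
  · rw [h₁.card] at this
    obtain ⟨hold, h5, h4⟩ := this
    rw [forall_lt_succ hi]
    simp only [setVar_arr, P]
    refine ⟨hold, ?_, ?_⟩
    · rw [h5, Digraph.isSource_iff_forall_reaches hD]; simp
    · rw [h4, Digraph.isSink_iff_forall_reaches hD]; simp
  · refine ⟨fun v hv => ?_, ?_, ?_⟩
    · simpa [P, setVar_arr, hs₁', setArr_arr, hv.ne] using inv₁ v hv
    · simp [setVar_arr, hs₁', setArr_arr]
    · simp [setVar_arr, hs₁', setArr_arr]
  · intro j hj s₂ hj₂ hv₂ ha₂ inv₂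
    rw [h₁.card] at hj
    have h₂ : HoldsReach D s₂ := h₁.congr (hv₂ 0 rfl) (ha₂ 0 rfl) (ha₂ 3 rfl)
    have hstep := classifyStep_run h₂ (i := ⟨i, hi⟩) (j := ⟨j, hj⟩)
      ((hv₂ 1 rfl).trans hi₁) hj₂
    obtain ⟨hold, h5, h4⟩ := inv₂
    rw [forall_lt_succ hj, forall_lt_succ hj]
    simp only [setVar_arr, P, hstep]
    refine ⟨fun v hv => ?_, ?_, ?_⟩
    · simpa [hv.ne] using hold v hv
    · rw [← h5]; simp; tauto
    · rw [← h4]; simp; tauto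

/-! ### The greedy algorithm -/

/-- In addition to the reachability matrix, array `5` marks the sources. -/
structure HoldsInstance (D : Digraph (Fin n)) (s : State) : Prop extends HoldsReach D s where
  source : ∀ v : Fin n, s.arr 5 v ≠ 0 ↔ D.IsSource v

theorem HoldsInstance.of_frame {s s' : State} (h : HoldsInstance D s) (h0 : s'.var 0 = s.var 0)
    (ha0 : s'.arr 0 = s.arr 0) (ha3 : s'.arr 3 = s.arr 3) (ha5 : s'.arr 5 = s.arr 5) :
    HoldsInstance D s' :=
  ⟨h.toHoldsReach.congr h0 ha0 ha3, fun v => by rw [ha5, h.source]⟩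

/-- Array `1` marks the elements of `C`, and array `4` marks the sinks that `C` does not reach. -/
def HoldsPartialCover (D : Digraph (Fin n)) (C : Finset (Fin n)) (m : ℕ → ℕ → ℕ) : Prop :=
  (∀ v : Fin n, m 1 v = 1 ↔ v ∈ C) ∧ ∀ t : Fin n, m 4 t ≠ 0 ↔ t ∈ D.uncovered C

/-- Set register `7` to `0` if the source in register `5` reaches the sink in register `2` and the
uncovered sink in register `6`, but the source in register `1` does not reach the latter. -/
def checkStep : Prog :=
  .ite (.get 5 (.var 5)) (.ite (entry 5 2) (.ite (.get 4 (.var 6)) (.ite (entry 5 6)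
    (.ite (entry 1 6) .skip (.assign 7 (.lit 0))) .skip) .skip) .skip) .skip

/-- Decide whether the source in register `1` dominates at the sink in register `2`; the answer is
returned in register `7`. -/
def checkProg : Prog :=
  .seq (.assign 7 (.lit 1)) (.forVar 5 (.forVar 6 checkStep))

theorem checkStep_run {s : State} (h : HoldsInstance D s) {U : Set (Fin n)}
    (hU : ∀ t : Fin n, s.arr 4 t ≠ 0 ↔ t ∈ U) {p q i j : Fin n} (hp : s.var 1 = p)
    (hq : s.var 2 = q) (hi : s.var 5 = i) (hj : s.var 6 = j) :
    (checkStep.run s).var 7 ≠ 0 ↔ s.var 7 ≠ 0 ∧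
      (D.IsSource i → D.Reaches i q → j ∈ U → D.Reaches i j → D.Reaches p j) := by
  have e1 : (Expr.get 5 (.var 5)).eval s ≠ 0 ↔ D.IsSource i := by
    simp only [Expr.eval, hi, h.source]
  have e2 := h.eval_entry hi hq
  have e3 : (Expr.get 4 (.var 6)).eval s ≠ 0 ↔ j ∈ U := by
    simp only [Expr.eval, hj, hU]
  have e4 := h.eval_entry hi hj
  have e5 := h.eval_entry hp hj
  rw [← e1, ← e2, ← e3, ← e4, ← e5]
  simp only [checkStep, run]
  split_ifs <;> simp_all [setVar_var, Expr.eval]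

theorem checkProg_run {s : State} (h : HoldsInstance D s) {U : Set (Fin n)}
    (hU : ∀ t : Fin n, s.arr 4 t ≠ 0 ↔ t ∈ U) {p q : Fin n} (hp : s.var 1 = p)
    (hq : s.var 2 = q) :
    (checkProg.run s).var 7 ≠ 0 ↔ ∀ s', D.IsSource s' → D.Reaches s' q →
      ∀ t' ∈ U, D.Reaches s' t' → D.Reaches p t' := by
  set s₀ := s.setVar 7 1 with hs₀
  have hn₀ : s₀.var 0 = n := h.card
  have := run_forVar_induction (s := s₀) (x := 5) (c := .forVar 6 checkStep)
    (fun k s' => s'.var 7 ≠ 0 ↔ ∀ i : Fin n, (i : ℕ) < k → ∀ j : Fin n, D.IsSource i →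
      D.Reaches i q → j ∈ U → D.Reaches i j → D.Reaches p j) ?_ ?_
  · rw [hn₀] at this
    refine Iff.trans this ⟨fun h i hi hiq j hj => h i i.2 j hi hiq hj, fun h i _ j hi hiq hj =>
      h i hi hiq j hj⟩
  · simp [setVar_var, hs₀]
  intro i hi s₁ hi₁ hv₁ ha₁ inv₁
  rw [hn₀] at hi
  have hn₁ : s₁.var 0 = n := (hv₁ 0 rfl).trans hn₀
  have := run_forVar_induction (s := s₁) (x := 6) (c := checkStep)
    (fun k s' => s'.var 7 ≠ 0 ↔ s₁.var 7 ≠ 0 ∧ ∀ j : Fin n, (j : ℕ) < k → D.IsSource ⟨i, hi⟩ →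
      D.Reaches ⟨i, hi⟩ q → j ∈ U → D.Reaches ⟨i, hi⟩ j → D.Reaches p j) ?_ ?_
  · rw [hn₁, inv₁] at this
    rw [forall_lt_succ hi]
    refine Iff.trans this (and_congr_right fun _ => ⟨fun h j => h j j.2, fun h j _ => h j⟩)
  · simp [setVar_var]
  intro j hj s₂ hj₂ hv₂ ha₂ inv₂
  rw [hn₁] at hj
  have hv : ∀ y, (Prog.forVar 5 (.forVar 6 checkStep)).assigns y = false →
      (Prog.forVar 6 checkStep).assigns y = false → s₂.var y = s₀.var y := fun y h h' =>
    (hv₂ y h').trans (hv₁ y h)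
  have h₂ : HoldsInstance D s₂ := by
    refine h.of_frame (hv 0 rfl rfl) ?_ ?_ ?_ <;> rw [ha₂ _ rfl, ha₁ _ rfl] <;> rfl
  have hU₂ : ∀ t : Fin n, s₂.arr 4 t ≠ 0 ↔ t ∈ U := by
    intro t
    rw [ha₂ 4 rfl, ha₁ 4 rfl]
    exact hU t
  have hstep := checkStep_run h₂ hU₂ (i := ⟨i, hi⟩) (j := ⟨j, hj⟩) ((hv 1 rfl rfl).trans hp)
    ((hv 2 rfl rfl).trans hq) ((hv₂ 5 rfl).trans hi₁) hj₂
  have h7 : ((checkStep.run s₂).setVar 6 (j + 1)).var 7 = (checkStep.run s₂).var 7 := by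
    simp [setVar_var]
  rw [h7, hstep, inv₂, forall_lt_succ hj, and_assoc]

/-- Cover the sink in register `6` if it is reachable from the source in register `1`. -/
def coverStep : Prog := .ite (entry 1 6) (.store 4 (.var 6) (.lit 0)) .skip

/-- Select the source in register `1`. -/
def selectProg : Prog := .seq (.store 1 (.var 1) (.lit 1)) (.forVar 6 coverStep)

theorem selectProg_run {s : State} (h : HoldsReach D s) {C : Finset (Fin n)} {p : Fin n}
    (hC : HoldsPartialCover D C s.arr) (hp : s.var 1 = p) :
    HoldsPartialCover D (insert p C) (selectProg.run s).arr := by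
  have h1 : (selectProg.run s).arr 1 = (s.setArr 1 p 1).arr 1 := by
    have := run_arr (.forVar 6 coverStep) (s.setArr 1 p 1) (a := 1) rfl
    rw [← this]
    simp [selectProg, run, Expr.eval, hp]
  refine ⟨fun v => ?_, fun t => ?_⟩
  · rw [h1, setArr_arr, Finset.mem_insert, ← hC.1, Fin.ext_iff]
    by_cases hv : (v : ℕ) = p <;> simp [hv]
  set s₀ := s.setArr 1 p 1 with hs₀
  have h₀ : HoldsReach D s₀ := h.congr rfl (by ext; simp [hs₀, setArr_arr])
    (by ext; simp [hs₀, setArr_arr])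
  have hrun : selectProg.run s = (Prog.forVar 6 coverStep).run s₀ := by
    simp [selectProg, run, Expr.eval, hp, hs₀]
  rw [hrun]
  have := run_forVar_induction (s := s₀) (x := 6) (c := coverStep)
    (fun k s' => ∀ t : Fin n, s'.arr 4 t ≠ 0 ↔
      t ∈ D.uncovered C ∧ ((t : ℕ) < k → ¬ D.Reaches p t)) ?_ ?_
  · rw [h₀.card] at this
    rw [this t, Digraph.mem_uncovered_insert]
    simp
  · intro t
    simpa [setVar_arr, hs₀, setArr_arr] using hC.2 t
  intro j hj s₁ hj₁ hv₁ ha₁ inv₁ t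
  rw [h₀.card] at hj
  have h₁ : HoldsReach D s₁ := h₀.congr (hv₁ 0 rfl) (ha₁ 0 rfl) (ha₁ 3 rfl)
  have e := h₁.eval_entry (i := p) (j := ⟨j, hj⟩) ((hv₁ 1 rfl).trans hp) hj₁
  have hlt : (t : ℕ) < j + 1 ↔ (t : ℕ) < j ∨ t = ⟨j, hj⟩ := by
    rw [Fin.ext_iff]
    exact Nat.lt_succ_iff_lt_or_eq
  have hinv := inv₁ t
  have hirr : ∀ h : t = ⟨j, hj⟩, ¬ (t : ℕ) < j := fun h => by rw [h]; exact lt_irrefl _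
  simp only [setVar_arr, coverStep, run]
  by_cases hr : D.Reaches p ⟨j, hj⟩
  · rw [if_pos (e.2 hr), setArr_arr, hlt]
    simp only [Expr.eval, hj₁, true_and]
    by_cases ht : t = ⟨j, hj⟩
    · subst ht
      simp [hr]
    · have : (t : ℕ) ≠ j := fun h => ht (Fin.ext h)
      simp only [this, if_false, ht, or_false]
      exact hinv
  · rw [if_neg (fun h => hr (e.1 h)), hinv, hlt]
    by_cases ht : t = ⟨j, hj⟩
    · subst ht
      simp [hr]
    · simp [ht]

/-- If the source in register `1` dominates at the sink in register `2`, select it. -/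
def greedyStep : Prog :=
  .ite (.get 5 (.var 1)) (.ite (.get 4 (.var 2)) (.ite (entry 1 2)
    (.seq checkProg (.ite (.var 7) selectProg .skip)) .skip) .skip) .skip

open Classical in
theorem greedyStep_run {s : State} (h : HoldsInstance D s) {C : Finset (Fin n)} {p q : Fin n}
    (hC : HoldsPartialCover D C s.arr) (hp : s.var 1 = p) (hq : s.var 2 = q) :
    HoldsPartialCover D (if D.Dominates (D.uncovered C) p q then insert p C else C)
      (greedyStep.run s).arr := by
  have e1 : (Expr.get 5 (.var 1)).eval s ≠ 0 ↔ D.IsSource p := by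
    simp only [Expr.eval, hp, h.source]
  have e2 : (Expr.get 4 (.var 2)).eval s ≠ 0 ↔ q ∈ D.uncovered C := by
    simp only [Expr.eval, hq, hC.2]
  have e3 := h.eval_entry hp hq
  have e4 : (Expr.var 7).eval (checkProg.run s) ≠ 0 ↔ _ := checkProg_run h hC.2 hp hq
  have hC' : HoldsPartialCover D C (checkProg.run s).arr := by
    rw [HoldsPartialCover, run_arr checkProg s (a := 1) rfl, run_arr checkProg s (a := 4) rfl]
    exact hC
  have h' : HoldsReach D (checkProg.run s) :=
    h.toHoldsReach.congr (run_var _ _ rfl) (run_arr _ _ rfl) (run_arr _ _ rfl)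
  have hp' : (checkProg.run s).var 1 = p := (run_var _ _ rfl).trans hp
  by_cases hdom : D.Dominates (D.uncovered C) p q
  · simp only [greedyStep, run, if_pos (e1.2 hdom.1), if_pos (e2.2 hdom.2.1),
      if_pos (e3.2 hdom.2.2.1), if_pos (e4.2 hdom.2.2.2), if_pos hdom]
    exact selectProg_run h' hC' hp'
  · rw [if_neg hdom]
    simp only [greedyStep, run]
    split_ifs with h1 h2 h3 h4
    · exact absurd ⟨e1.1 h1, e2.1 h2, e3.1 h3, e4.1 h4⟩ hdom
    all_goals assumption

/-- One round: try all pairs of a source and a sink. -/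
def roundProg : Prog := .forVar 1 (.forVar 2 greedyStep)

theorem roundProg_run {s : State} (h : HoldsInstance D s) {C : Finset (Fin n)}
    (hC : HoldsPartialCover D C s.arr) (hext : D.IsExtendable C) :
    ∃ C', HoldsPartialCover D C' (roundProg.run s).arr ∧ D.IsExtendable C' ∧
      D.uncovered C' ⊆ D.uncovered C ∧
      ∀ p q, D.Dominates (D.uncovered C) p q → q ∉ D.uncovered C' := by
  classical
  -- the invariant when the pairs lexicographically below `(i, j)` have been tried
  let Inv : ℕ → ℕ → State → Prop := fun i j s' => ∃ C', HoldsPartialCover D C' s'.arr ∧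
    D.IsExtendable C' ∧ D.uncovered C' ⊆ D.uncovered C ∧
    ∀ p q : Fin n, ((p : ℕ) < i ∨ ((p : ℕ) = i ∧ (q : ℕ) < j)) →
      D.Dominates (D.uncovered C) p q → q ∉ D.uncovered C'
  have := run_forVar_induction (s := s) (x := 1) (c := .forVar 2 greedyStep)
    (fun i => Inv i 0) ⟨C, hC, hext, subset_rfl, fun p q h => by omega⟩ ?_
  · rw [h.card] at this
    obtain ⟨C', h1, h2, h3, h4⟩ := this
    exact ⟨C', h1, h2, h3, fun p q => h4 p q (.inl p.2)⟩
  intro i hi s₁ hi₁ hv₁ ha₁ inv₁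
  have hn₁ : s₁.var 0 = n := (hv₁ 0 rfl).trans h.card
  have := run_forVar_induction (s := s₁) (x := 2) (c := greedyStep) (fun j => Inv i j) inv₁ ?_
  · rw [hn₁] at this
    obtain ⟨C', h1, h2, h3, h4⟩ := this
    refine ⟨C', h1, h2, h3, fun p q hpq => h4 p q ?_⟩
    have := q.2
    omega
  rintro j hj s₂ hj₂ hv₂ ha₂ ⟨C', h1, h2, h3, h4⟩
  rw [h.card] at hi
  rw [hn₁] at hj
  have h₂ : HoldsInstance D s₂ := by
    refine h.of_frame ((hv₂ 0 rfl).trans (hv₁ 0 rfl)) ?_ ?_ ?_ <;> rw [ha₂ _ rfl, ha₁ _ rfl]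
  have hstep := greedyStep_run (p := ⟨i, hi⟩) (q := ⟨j, hj⟩) h₂ h1 ((hv₂ 1 rfl).trans hi₁) hj₂
  refine ⟨_, hstep, ?_⟩
  split_ifs with hdom
  · refine ⟨h2.insert hdom, fun t ht => h3 (Digraph.mem_uncovered_insert.1 ht).1, ?_⟩
    intro p q hpq hdom' hq
    obtain ⟨hq, hnr⟩ := Digraph.mem_uncovered_insert.1 hq
    by_cases hpq' : (p : ℕ) = i ∧ (q : ℕ) = j
    · obtain ⟨rfl, rfl⟩ := hpq'
      exact hnr hdom'.2.2.1
    · exact h4 p q (by omega) hdom' hq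
  · refine ⟨h2, h3, fun p q hpq hdom' hq => ?_⟩
    by_cases hpq' : (p : ℕ) = i ∧ (q : ℕ) = j
    · obtain ⟨rfl, rfl⟩ := hpq'
      exact hdom (hdom'.anti h3 hq)
    · exact h4 p q (by omega) hdom' hq

/-- Perform `n` rounds; in each of them a sink is covered unless none is left. -/
def greedyProg : Prog := .forVar 4 roundProg

theorem greedyProg_run {s : State} (h : HoldsInstance D s) (hD : D.IsAcyclic)
    (hno : ∀ k, 6 ≤ k → ¬ (SimpleGraph.cycleGraph k).IsIndContained D.underlying)
    (h0 : HoldsPartialCover D ∅ s.arr) :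
    D.IsMinimumSourceCover (output n (greedyProg.run s)) := by
  -- after `k` rounds at most `n - k` sinks are uncovered
  have := run_forVar_induction (s := s) (x := 4) (c := roundProg)
    (fun k s' => ∃ C, HoldsPartialCover D C s'.arr ∧ D.IsExtendable C ∧
      (D.uncovered C).ncard ≤ n - k) ?_ ?_
  · rw [h.card] at this
    obtain ⟨C, h1, h2, h3⟩ := this
    have hout : output n (greedyProg.run s) = C := by
      ext v
      rw [output, Finset.mem_filter, and_iff_right (Finset.mem_univ v)]
      exact h1.1 v
    rw [hout]
    refine h2.isMinimumSourceCover ((Set.ncard_eq_zero (Set.toFinite _)).1 ?_)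
    omega
  · refine ⟨∅, h0, Digraph.isExtendable_empty, ?_⟩
    simpa using Set.ncard_le_card (D.uncovered ∅)
  rintro k hk s₁ - hv₁ ha₁ ⟨C, h1, h2, h3⟩
  have h₁ : HoldsInstance D s₁ := h.of_frame (hv₁ 0 rfl) (ha₁ 0 rfl) (ha₁ 3 rfl) (ha₁ 5 rfl)
  obtain ⟨C', h1', h2', hsub, hdom⟩ := roundProg_run h₁ h1 h2
  refine ⟨C', h1', h2', ?_⟩
  rcases (D.uncovered C).eq_empty_or_nonempty with hemp | hne
  · rw [hemp] at hsub
    simp [Set.subset_empty_iff.1 hsub]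
  · obtain ⟨p, hp, q, hq, hpq, hmax⟩ := hD.exists_dominating_source hno hne
    have := Set.ncard_lt_ncard (s := D.uncovered C') (t := D.uncovered C)
      ⟨hsub, fun h => hdom p q ⟨hp, hq, hpq, hmax⟩ (h hq)⟩ (Set.toFinite _)
    omega

/-- Compute a minimum source cover. Array `0` holds the adjacency matrix and later the reachability
matrix, array `1` the selected sources, array `3` the row offsets, array `4` the uncovered sinks,
and array `5` the sources. -/
def sourceCoverProg : Prog := .seq initProg (.seq closureProg (.seq classifyProg greedyProg))

theorem input_arr_zero (i j : Fin n) : (input D).arr 0 (i * n + j) ≠ 0 ↔ D.Adj i j := by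
  simp only [input, true_and, ne_eq, ite_eq_right_iff, one_ne_zero, imp_false, not_not]
  refine ⟨?_, fun h => ⟨i, j, rfl, h⟩⟩
  rintro ⟨i', j', h, hadj⟩
  obtain ⟨hi, hj⟩ := (mul_add_inj j.2 j'.2).1 h
  rwa [Fin.ext hi, Fin.ext hj]

theorem sourceCoverProg_run (hD : D.IsAcyclic)
    (hno : ∀ k, 6 ≤ k → ¬ (SimpleGraph.cycleGraph k).IsIndContained D.underlying) :
    D.IsMinimumSourceCover (output n (sourceCoverProg.run (input D))) := by
  have hn : (input D).var 0 = n := rfl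
  obtain ⟨hrow, hdiag⟩ := initProg_run hn
  set s₁ := initProg.run (input D) with hs₁
  have hn₁ : s₁.var 0 = n := run_var _ _ rfl
  have hreach := closureProg_run hn₁ hrow (r := D.Adj) fun i j => by
    rw [hdiag i j, input_arr_zero]
  set s₂ := closureProg.run s₁ with hs₂
  have h₂ : HoldsReach D s₂ := ⟨(run_var _ _ rfl).trans hn₁, fun i hi => by
    rw [hs₂, run_arr _ _ rfl, hrow i hi], hreach⟩
  have hcl := classifyProg_run h₂ hD
  set s₃ := classifyProg.run s₂
  have h₃ : HoldsInstance D s₃ :=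
    ⟨h₂.congr (run_var _ _ rfl) (run_arr _ _ rfl) (run_arr _ _ rfl), fun v => (hcl v).1⟩
  refine greedyProg_run h₃ hD hno ⟨fun v => ?_, fun t => ?_⟩
  · rw [run_arr classifyProg _ rfl, run_arr closureProg _ rfl, run_arr initProg _ rfl]
    simp [input]
  · rw [(hcl t).2]
    simp [Digraph.uncovered]

end RAM

theorem mainTheorem9 :
    (∃ (prog : RAM.Cmd) (p : Polynomial ℕ),
      ∀ (n : ℕ) (D : Digraph (Fin n)),
        D.IsSourceCoverInstance → D.underlying.IsChordalBipartite →
        ∃ (s : RAM.State) (t : ℕ),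
          RAM.Exec prog (RAM.input D) s t ∧ t ≤ p.eval n ∧
          D.IsMinimumSourceCover (RAM.output n s)) ∧
    (∀ (V : Type*) [Finite V] (D : Digraph V),
      D.IsSourceCoverInstance → D.underlying.IsChordalBipartite →
      D.flatten.underlying.IsChordalBipartite) := by
  refine ⟨⟨RAM.sourceCoverProg.compile, RAM.sourceCoverProg.time, fun n D hD hG => ?_⟩,
    fun V _ D hD hG => hD.acyclic.flatten_isChordalBipartite hG.2⟩
  obtain ⟨t, ht, hle⟩ := RAM.sourceCoverProg.exec_compile rfl rfl (RAM.input D)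
  exact ⟨_, t, ht, hle, RAM.sourceCoverProg_run hD.acyclic hG.2⟩
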